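/- Let $R$ be an irreducible reduced crystallographic root system (the root system of a simple Lie algebra), with simple roots $\alpha_1,\dots,\alpha_r$, highest root $\Theta$, Weyl group $W$, weight lattice $P$ and coweight lattice $P^\vee$. Let $S=\operatorname{Sym}_{\mathbb Z}(P)$ and let $\widetilde W_{\rm aff}=P^\vee\rtimes W$, with translations $t_\lambda$ $(\lambda\in P^\vee)$, act on $S$ through $W$. Put $s_i=s_{\alpha_i}$ for $1\le i\le r$ and $s_0=t_{\Theta^\vee}s_\Theta$, and let $Z\subset\widetilde W_{\rm aff}$ be the stabilizer of the fundamental alcove. Every $x\in\widetilde W_{\rm aff}$ can be written $x=\tau s_{i_1}\cdots s_{i_\ell}$ with $\tau\in Z$ and $i_1,\dots,i_\ell\in\{0,\dots,r\}$; the least possible $\ell$ is the length $\ell(x)$. Let $\widetilde W_{\rm aff}^-$ be the set of elements of minimal length in the cosets $xW$. In the twisted group ring $\widetilde Q_{\rm aff}=\bigoplus_{x\in\widetilde W_{\rm aff}}\operatorname{Frac}(S)\,\delta_x$, where $\delta_x\delta_y=\delta_{xy}$ and $\delta_x f=x(f)\delta_x$, put $A_i=\frac1{\alpha_i}(\delta_e-\delta_{s_i})$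 for $1\le i\le r$, $A_0=-\frac1{\Theta}(\delta_e-\delta_{s_0})$, and $\widetilde A_x=\delta_\tau A_{i_1}\cdots A_{i_\ell}$ for an expression $x=\tau s_{i_1}\cdots s_{i_\ell}$ as above with $\ell=\ell(x)$ (this depends only on $x$). The extended affine nil-Hecke ring $\widetilde{\mathbb A}_{\rm aff}=\bigoplus_x S\,\widetilde A_x$ is the subring generated by $S$, the $A_i$ $(0\le i\le r)$ and the $\delta_\tau$ $(\tau\in Z)$; $Z_{\widetilde{\mathbb A}_{\rm aff}}(S)$ is the centralizer of $S$ in it. The equivariant homology of the adjoint affine Grassmannian is taken in its algebraic model: $H_*^T(\Omega K^{\rm ad})$ is the $S$-subalgebra $\widetilde{\mathbb A}_{\rm aff}\cdot[{\rm pt}]$ of the localized homology $\operatorname{Frac}(S)[P^\vee]$, the group algebra with basis the classes $\widetilde\psi_{t_\lambda}$ of the $T$-fixed points, where $f\delta_{t_\lambda w}\cdot[{\rm pt}]=f\,\widetilde\psi_{t_\lambda}$ for $f\in\operatorname{Frac}(S)$, $\lambda\in P^\vee$, $w\in W$. Its Schubert classes are $\xi_w=\widetilde A_w\cdot[{\rm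 pt}]$, $w\in\widetilde W_{\rm aff}^-$. Let $$j^{\rm ad}:H_*^T(\Omega K^{\rm ad})\xrightarrow{\ \sim\ }Z_{\widetilde{\mathbb A}_{\rm aff}}(S)$$ be the isomorphism of $S$-algebras obtained from the $\operatorname{Frac}(S)$-linear map with $\widetilde\psi_{t_\lambda}\mapsto\delta_{t_\lambda}$ for $\lambda\in P^\vee$. **Proposition.** Let $\mu^\vee\in P^\vee$ be antidominant, i.e. $\langle\alpha_i,\mu^\vee\rangle\le 0$ for $1\le i\le r$, and let $W_{\mu^\vee}=\{w\in W: w(\mu^\vee)=\mu^\vee\}$. Then $W_{\mu^\vee}$ is generated by the $s_{\alpha_i}$, $1\le i\le r$, with $\langle\alpha_i,\mu^\vee\rangle=0$; moreover $t_{\mu^\vee}\in\widetilde W_{\rm aff}^-$ and $$j^{\rm ad}(\xi_{t_{\mu^\vee}})=\sum_{w\in W/W_{\mu^\vee}}\widetilde A_{t_{w(\mu^\vee)}}.$$ -/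

import Mathlib

set_option linter.unusedSectionVars false

noncomputable section

namespace AffineNilHecke

open scoped Pointwise

variable {ι V N : Type*} [AddCommGroup V] [Module ℝ V] [AddCommGroup N] [Module ℝ N]
  (R : RootPairing ι ℝ V N)

/-! ### Lattices and Weyl group actions -/

/-- The weight lattice `P`: vectors pairing integrally with all coroots. -/
def weightLattice : Submodule ℤ V where
  carrier := {v | ∀ i, ∃ n : ℤ, R.toLinearMap v (R.coroot i) = n}
  add_mem' {v w} hv hw i := by
    obtain ⟨m, hm⟩ := hv i
    obtain ⟨n, hn⟩ := hw i
    exact ⟨m + n, by simp [hm, hn]⟩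
  zero_mem' i := ⟨0, by simp⟩
  smul_mem' c v hv i := by
    obtain ⟨m, hm⟩ := hv i
    exact ⟨c * m, by simp [hm]⟩

/-- The coweight lattice `P^∨`: covectors pairing integrally with all roots. -/
def coweightLattice : Submodule ℤ N where
  carrier := {y | ∀ i, ∃ n : ℤ, R.toLinearMap (R.root i) y = n}
  add_mem' {v w} hv hw i := by
    obtain ⟨m, hm⟩ := hv i
    obtain ⟨n, hn⟩ := hw i
    exact ⟨m + n, by simp [hm, hn]⟩
  zero_mem' i := ⟨0, by simp⟩
  smul_mem' c v hv i := by
    obtain ⟨m, hm⟩ := hv i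
    exact ⟨c * m, by simp [hm]⟩

/-- The action of the Weyl group on the real coweight space, contragredient to the action on
the weight space: `⟨w v, w y⟩ = ⟨v, y⟩`. -/
def coweightRep : R.weylGroup →* (N ≃ₗ[ℝ] N) where
  toFun w := RootPairing.Equiv.coweightEquiv R R (w⁻¹ : R.weylGroup).1
  map_one' := by ext; simp
  map_mul' x y := by ext; simp

lemma pairing_weyl (w : R.weylGroup) (v : V) (y : N) :
    R.toLinearMap (w • v) (coweightRep R w y) = R.toLinearMap v y := by
  have h := RootPairing.Hom.weight_coweight_transpose_apply R R
    (coweightRep R w y) (w : R.Aut).toHom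
  have h' := LinearMap.congr_fun h v
  have e : (w : R.Aut).coweightMap (coweightRep R w y) = y := by
    simp [coweightRep]
  rw [e] at h'
  exact h'

lemma weyl_smul_mem (w : R.weylGroup) {v : V} (hv : v ∈ weightLattice R) :
    w • v ∈ weightLattice R := by
  intro i
  have h := pairing_weyl R w v (coweightRep R w⁻¹ (R.coroot i))
  have e : coweightRep R w (coweightRep R w⁻¹ (R.coroot i)) = R.coroot i := by
    rw [← LinearEquiv.mul_apply, ← map_mul]; simp
  rw [e] at h
  have e' : coweightRep R w⁻¹ (R.coroot i) = R.coroot ((w : R.Aut).indexEquiv.symm i) := by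
    have := RootPairing.Hom.coroot_coweightMap_apply R R i (w : R.Aut).toHom
    simpa [coweightRep] using this
  rw [h, e']
  exact hv _

lemma coweightRep_mem (w : R.weylGroup) {y : N} (hy : y ∈ coweightLattice R) :
    coweightRep R w y ∈ coweightLattice R := by
  intro i
  have h := pairing_weyl R w (w⁻¹ • R.root i) y
  rw [smul_inv_smul] at h
  rw [h, RootPairing.weylGroup_apply_root]
  exact hy _

instance : DistribMulAction R.weylGroup (weightLattice R) where
  smul w v := ⟨w • (v : V), weyl_smul_mem R w v.2⟩
  one_smul v := Subtype.ext (one_smul _ (v : V))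
  mul_smul w w' v := Subtype.ext (mul_smul w w' (v : V))
  smul_zero w := Subtype.ext (smul_zero w)
  smul_add w v v' := Subtype.ext (smul_add w (v : V) v')

instance : DistribMulAction R.weylGroup (coweightLattice R) where
  smul w y := ⟨coweightRep R w y, coweightRep_mem R w y.2⟩
  one_smul y := Subtype.ext (LinearEquiv.congr_fun (map_one (coweightRep R)) (y : N))
  mul_smul w w' y := Subtype.ext (LinearEquiv.congr_fun (map_mul (coweightRep R) w w') (y : N))
  smul_zero _ := Subtype.ext (map_zero _)
  smul_add _ _ _ := Subtype.ext (map_add _ _ _)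

@[simp] lemma coe_smul_weight (w : R.weylGroup) (v : weightLattice R) :
    ((w • v : weightLattice R) : V) = w • (v : V) := rfl

@[simp] lemma coe_smul_coweight (w : R.weylGroup) (y : coweightLattice R) :
    ((w • y : coweightLattice R) : N) = coweightRep R w y := rfl

/-- The ring `S`: the symmetric algebra over `ℤ` of the weight lattice. -/
abbrev SymP : Type _ := SymmetricAlgebra ℤ (weightLattice R)

/-- The Weyl group acts on `S` by ring automorphisms extending its action on weights. -/
instance : MulSemiringAction R.weylGroup (SymP R) where
  smul w s := SymmetricAlgebra.lift (SymmetricAlgebra.ι ℤ (weightLattice R) ∘ₗ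
    (DistribSMul.toAddMonoidHom (weightLattice R) w).toIntLinearMap) s
  one_smul s := by
    change SymmetricAlgebra.lift _ s = AlgHom.id ℤ _ s
    congr 1
    ext v
    simp
  mul_smul w w' s := by
    change SymmetricAlgebra.lift _ s =
      (SymmetricAlgebra.lift _).comp (SymmetricAlgebra.lift _) s
    congr 1
    ext v
    simp [mul_smul]
  smul_zero w := map_zero _
  smul_add w := map_add _
  smul_one w := map_one _
  smul_mul w := map_mul _

lemma smul_ι (w : R.weylGroup) (v : weightLattice R) :
    w • (SymmetricAlgebra.ι ℤ (weightLattice R) v : SymP R) =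
      SymmetricAlgebra.ι ℤ (weightLattice R) (w • v) :=
  SymmetricAlgebra.lift_ι_apply _ _

/-- The integer `⟨v, α_i^∨⟩` for a weight `v`. -/
def pairZ (v : weightLattice R) (i : ι) : ℤ := (v.2 i).choose

lemma pairZ_spec (v : weightLattice R) (i : ι) :
    (pairZ R v i : ℝ) = R.toLinearMap (v : V) (R.coroot i) := (v.2 i).choose_spec.symm

instance [Finite ι] [R.IsRootSystem] : Module.Free ℤ (weightLattice R) := by
  let f : weightLattice R →+ (ι → ℤ) :=
    { toFun := pairZ R
      map_zero' := by
        ext i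
        have : ((pairZ R 0 i : ℤ) : ℝ) = 0 := by rw [pairZ_spec]; simp
        exact_mod_cast this
      map_add' := fun v w => by
        ext i
        have : ((pairZ R (v + w) i : ℤ) : ℝ) = pairZ R v i + pairZ R w i := by
          simp only [pairZ_spec]; simp
        exact_mod_cast this }
  have hf : Function.Injective f.toIntLinearMap := by
    intro v w h
    apply Subtype.ext
    apply R.toPerfPair.injective
    refine LinearMap.ext_on_range (v := R.coroot) ?_ fun i => ?_
    · exact RootPairing.IsRootSystem.span_coroot_eq_top
    · have : pairZ R v i = pairZ R w i := congrFun h i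
      change R.toLinearMap (v : V) (R.coroot i) = R.toLinearMap (w : V) (R.coroot i)
      rw [← pairZ_spec, ← pairZ_spec, this]
  exact Module.Free.of_equiv (LinearEquiv.ofInjective _ hf).symm


/-! ### The extended affine Weyl group -/

/-- The action of `W` on the multiplicatively written coweight lattice. -/
def translationAut : R.weylGroup →* MulAut (Multiplicative (coweightLattice R)) where
  toFun w := AddEquiv.toMultiplicative (DistribMulAction.toAddEquiv (coweightLattice R) w)
  map_one' := MulEquiv.ext fun y => congrArg Multiplicative.ofAdd (one_smul R.weylGroup y.toAdd)
  map_mul' w w' := MulEquiv.ext fun y => congrArg Multiplicative.ofAdd (mul_smul w w' y.toAdd)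

/-- The extended affine Weyl group `P^∨ ⋊ W`. -/
abbrev ExtAffWeyl : Type _ :=
  Multiplicative (coweightLattice R) ⋊[translationAut R] R.weylGroup

/-- The translation `t_μ`. -/
def trans (μ : coweightLattice R) : ExtAffWeyl R := SemidirectProduct.inl (.ofAdd μ)

/-- A finite Weyl group element, viewed in the extended affine Weyl group. -/
def fin (w : R.weylGroup) : ExtAffWeyl R := SemidirectProduct.inr w

/-- The coweight `λ` of `x = t_λ w`. -/
def transPart (x : ExtAffWeyl R) : coweightLattice R := x.left.toAdd

/-- The finite part `w` of `x = t_λ w`. -/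
def finPart : ExtAffWeyl R →* R.weylGroup := SemidirectProduct.rightHom

/-- The extended affine Weyl group acts on the real coweight space by affine transformations,
`t_λ w` sending `y` to `w y + λ`. -/
instance : MulAction (ExtAffWeyl R) N where
  smul x y := coweightRep R (finPart R x) y + (transPart R x : N)
  one_smul y := by
    change coweightRep R (finPart R 1) y + (transPart R 1 : N) = y
    simp [transPart]
  mul_smul x x' y := by
    change coweightRep R (finPart R (x * x')) y + (transPart R (x * x') : N) =
      coweightRep R (finPart R x) (coweightRep R (finPart R x') y + (transPart R x' : N)) +
        (transPart R x : N)
    have : (transPart R (x * x') : N) =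
      (transPart R x : N) + coweightRep R (finPart R x) (transPart R x' : N) := rfl
    rw [this]
    simp
    abel

variable [R.IsCrystallographic]

/-- The root `α_i` as a weight. -/
def rootWeight (i : ι) : weightLattice R :=
  ⟨R.root i, fun j => by
    obtain ⟨n, hn⟩ := R.exists_value (S := ℤ) i j
    exact ⟨n, by simpa using hn.symm⟩⟩

/-- The coroot `α_i^∨` as a coweight. -/
def corootCoweight (i : ι) : coweightLattice R :=
  ⟨R.coroot i, fun j => by
    obtain ⟨n, hn⟩ := R.exists_value (S := ℤ) j i
    exact ⟨n, by simpa using hn.symm⟩⟩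

/-- The finite reflection `s_α`. -/
def refl (i : ι) : R.weylGroup := RootPairing.weylGroup.ofIdx R i

variable {R}

/-- `θ` indexes the highest root: it exceeds each root by a sum of simple roots. -/
def IsHighestRoot (b : R.Base) (θ : ι) : Prop :=
  ∀ i, R.root θ - R.root i ∈ AddSubmonoid.closure (R.root '' b.support)

variable (b : R.Base) (θ : ι)

/-- The simple affine reflections: `s_i` for a simple root `α_i`, and `s_0 = t_{θ^∨} s_θ`. -/
def simpleRefl : Option b.support → ExtAffWeyl R
  | some i => fin R (refl R i)
  | none => trans R (corootCoweight R θ) * fin R (refl R θ)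

/-- The closed fundamental alcove. -/
def alcove : Set N :=
  {y | (∀ i ∈ b.support, 0 ≤ R.toLinearMap (R.root i) y) ∧ R.toLinearMap (R.root θ) y ≤ 1}

/-- The group `Z`: the stabilizer of the fundamental alcove. -/
def alcoveStabilizer : Subgroup (ExtAffWeyl R) :=
  MulAction.stabilizer (ExtAffWeyl R) (alcove b θ)

/-- An expression `x = τ s_{i₁} ⋯ s_{iₖ}` with `τ ∈ Z` and `i₁, …, iₖ ∈ I ∪ {0}`. -/
def IsExpression (x : ExtAffWeyl R) (e : alcoveStabilizer b θ × List (Option b.support)) : Prop :=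
  x = (e.1 : ExtAffWeyl R) * (e.2.map (simpleRefl b θ)).prod

/-- The length of `x = τ x̂`, i.e. the Coxeter length of its component `x̂` in the affine Weyl
group. -/
def length (x : ExtAffWeyl R) : ℕ := sInf {k | ∃ e, IsExpression b θ x e ∧ e.2.length = k}

/-- A reduced expression: `x = τ x̂` together with a reduced word for `x̂`. -/
def IsReducedExpression (x : ExtAffWeyl R)
    (e : alcoveStabilizer b θ × List (Option b.support)) : Prop :=
  IsExpression b θ x e ∧ e.2.length = length b θ x

/-- The elements of minimal length in their cosets `x W`. -/
def minReps : Set (ExtAffWeyl R) := {x | ∀ w : R.weylGroup, length b θ x ≤ length b θ (x * fin R w)}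

/-! ### The extended nil-Hecke ring -/

section NilHecke

variable (R) [Finite ι] [R.IsRootSystem]

/-- The fraction field of `S`. -/
abbrev FracS : Type _ := FractionRing (SymP R)

instance : MulSemiringAction R.weylGroup (FracS R) :=
  IsFractionRing.mulSemiringAction R.weylGroup (SymP R) (FracS R)

lemma weyl_smul_algebraMap (w : R.weylGroup) (s : SymP R) :
    w • algebraMap (SymP R) (FracS R) s = algebraMap (SymP R) (FracS R) (w • s) :=
  IsFractionRing.ringEquivOfRingEquiv_algebraMap _ _

/-- The extended affine Weyl group acts on `Frac S` through `W`: translations act trivially. -/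
instance : MulSemiringAction (ExtAffWeyl R) (FracS R) :=
  MulSemiringAction.compHom (FracS R) (finPart R)

lemma ext_smul_def (x : ExtAffWeyl R) (f : FracS R) : x • f = finPart R x • f := rfl

/-- The twisted group ring `⨁ₓ Frac(S) δₓ`, with `δₓ δᵧ = δₓᵧ` and `δₓ f = x(f) δₓ`. -/
abbrev TwistedRing : Type _ := SkewMonoidAlgebra (FracS R) (ExtAffWeyl R)

/-- The basis element `δₓ`. -/
def delta (x : ExtAffWeyl R) : TwistedRing R := SkewMonoidAlgebra.single x 1

/-- The inclusion `Frac S → ⨁ₓ Frac(S) δₓ`, `f ↦ f δ_e`. -/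
def scalar : FracS R →+* TwistedRing R := SkewMonoidAlgebra.singleOneRingHom

/-- The inclusion of `S` in the twisted group ring. -/
def scalarS : SymP R →+* TwistedRing R := (scalar R).comp (algebraMap (SymP R) (FracS R))

/-- The root `α_i` as an element of `S`. -/
def rootS (i : ι) : SymP R := SymmetricAlgebra.ι ℤ (weightLattice R) (rootWeight R i)

/-- The root `α_i` as an element of `Frac S`. -/
def rootF (i : ι) : FracS R := algebraMap (SymP R) (FracS R) (rootS R i)

variable {R}

/-- `A_i = α_i⁻¹ (δ_e - δ_{s_i})` for a simple root, and `A_0 = -θ⁻¹ (δ_e - δ_{s_0})`. -/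
def simpleA : Option b.support → TwistedRing R
  | some i => scalar R (rootF R i)⁻¹ * (1 - delta R (simpleRefl b θ (some i)))
  | none => scalar R (-(rootF R θ)⁻¹) * (1 - delta R (simpleRefl b θ none))

/-- The element `Ã_x = δ_τ A_{i₁} ⋯ A_{iₖ}` for a reduced expression `x = τ s_{i₁} ⋯ s_{iₖ}`.
(It is independent of the reduced expression.) -/
def tildeA (x : ExtAffWeyl R) : TwistedRing R :=
  let e := Classical.epsilon (IsReducedExpression b θ x)
  delta R e.1 * (e.2.map (simpleA b θ)).prod

/-- The extended nil-Hecke ring `Ã_aff`: the subring of the twisted group ring generated by `S`,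
the `A_i` for `i ∈ I ∪ {0}`, and the `δ_τ` for `τ ∈ Z`. -/
def nilHecke : Subring (TwistedRing R) :=
  Subring.closure (Set.range (scalarS R) ∪ Set.range (simpleA b θ) ∪
    delta R '' (alcoveStabilizer b θ : Set (ExtAffWeyl R)))

/-- The centralizer `Z_{Ã_aff}(S)` of `S` in the extended nil-Hecke ring. -/
def centralizerS : Subring (TwistedRing R) :=
  nilHecke b θ ⊓ Subring.centralizer (Set.range (scalarS R))

/-! #### Auxiliary computations -/

lemma scalar_apply (f : FracS R) : scalar R f = SkewMonoidAlgebra.single 1 f := rfl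

lemma scalar_mul_single (f g : FracS R) (x : ExtAffWeyl R) :
    scalar R f * SkewMonoidAlgebra.single x g = SkewMonoidAlgebra.single x (f * g) := by
  simp [scalar_apply]

lemma delta_mul (x y : ExtAffWeyl R) : delta R x * delta R y = delta R (x * y) := by
  simp [delta]

lemma delta_one : delta R (1 : ExtAffWeyl R) = 1 := rfl

lemma delta_mul_scalar (x : ExtAffWeyl R) (f : FracS R) :
    delta R x * scalar R f = scalar R (finPart R x • f) * delta R x := by
  simp [delta, scalar_apply, ext_smul_def]

lemma single_eq (x : ExtAffWeyl R) (f : FracS R) :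
    SkewMonoidAlgebra.single x f = scalar R f * delta R x := by
  simp [delta, scalar_apply]

lemma ι_injective : Function.Injective (SymmetricAlgebra.ι ℤ (weightLattice R)) := by
  intro v w h
  let B := Module.Free.chooseBasis ℤ (weightLattice R)
  refine B.ext_elem fun k => ?_
  have h2 := congrArg (SymmetricAlgebra.lift (B.coord k)) h
  rw [SymmetricAlgebra.lift_ι_apply, SymmetricAlgebra.lift_ι_apply] at h2
  exact h2

lemma rootS_ne_zero (i : ι) : rootS R i ≠ 0 := by
  intro h
  have h3 : rootWeight R i = 0 := ι_injective (h.trans (map_zero _).symm)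
  exact R.ne_zero i (congrArg Subtype.val h3)

lemma rootF_ne_zero (i : ι) : rootF R i ≠ 0 := by
  rw [rootF, Ne, FaithfulSMul.algebraMap_eq_zero_iff]
  exact rootS_ne_zero i

lemma scalarS_mem (s : SymP R) : scalarS R s ∈ nilHecke b θ :=
  Subring.subset_closure (Or.inl (Or.inl ⟨s, rfl⟩))

lemma simpleA_mem (i : Option b.support) : simpleA b θ i ∈ nilHecke b θ :=
  Subring.subset_closure (Or.inl (Or.inr ⟨i, rfl⟩))

lemma delta_mem_of_mem {τ : ExtAffWeyl R} (h : τ ∈ alcoveStabilizer b θ) :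
    delta R τ ∈ nilHecke b θ :=
  Subring.subset_closure (Or.inr ⟨τ, h, rfl⟩)

lemma tildeA_mem (x : ExtAffWeyl R) : tildeA b θ x ∈ nilHecke b θ := by
  refine mul_mem (delta_mem_of_mem b θ (Subtype.prop _)) (list_prod_mem fun a ha => ?_)
  obtain ⟨i, -, rfl⟩ := List.mem_map.1 ha
  exact simpleA_mem b θ i

/-- `α_i⁻¹ (1 - δ_{s_{α_i}})` for an arbitrary root. -/
def rootA (i : ι) : TwistedRing R :=
  scalar R (rootF R i)⁻¹ * (1 - delta R (fin R (refl R i)))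

lemma delta_refl (i : ι) :
    delta R (fin R (refl R i)) = 1 - scalarS R (rootS R i) * rootA i := by
  have : scalarS R (rootS R i) * scalar R (rootF R i)⁻¹ = 1 := by
    change scalar R (rootF R i) * _ = 1
    rw [← map_mul, mul_inv_cancel₀ (rootF_ne_zero i), map_one]
  rw [rootA, ← mul_assoc, this, one_mul, sub_sub_cancel]

lemma refl_smul_rootF (i j : ι) :
    refl R j • rootF R i = rootF R (R.reflectionPerm j i) := by
  rw [rootF, weyl_smul_algebraMap, rootF, rootS, smul_ι, rootS]
  congr 2
  apply Subtype.ext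
  simp [rootWeight, refl]

lemma refl_mul_self (j : ι) : refl R j * refl R j = 1 := by
  have := RootPairing.Equiv.reflection_inv R j
  apply Subtype.ext
  change RootPairing.Equiv.reflection R j * RootPairing.Equiv.reflection R j = 1
  rw [mul_eq_one_iff_eq_inv, this]

lemma refl_conj (i j : ι) :
    refl R (R.reflectionPerm j i) = refl R j * refl R i * refl R j := by
  apply Subtype.ext
  apply RootPairing.Equiv.weightHom_injective
  have : RootPairing.Equiv.weightHom R (refl R j * refl R i * refl R j : R.weylGroup).1 =
      RootPairing.Equiv.weightHom R (refl R j).1 * RootPairing.Equiv.weightHom R (refl R i).1 *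
      RootPairing.Equiv.weightHom R (refl R j).1 := by
    simp only [← map_mul]; rfl
  rw [this]
  simp only [refl, RootPairing.weylGroup.ofIdx, RootPairing.Equiv.weightHom_apply,
    RootPairing.Equiv.reflection_weightEquiv]
  exact R.reflection_reflectionPerm

lemma fin_mul (w w' : R.weylGroup) : fin R (w * w') = fin R w * fin R w' :=
  map_mul SemidirectProduct.inr w w'

lemma rootA_conj (i j : ι) :
    rootA (R.reflectionPerm j i) =
      delta R (fin R (refl R j)) * rootA i * delta R (fin R (refl R j)) := by
  have h1 : delta R (fin R (refl R j)) * scalar R (rootF R i)⁻¹ =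
      scalar R (rootF R (R.reflectionPerm j i))⁻¹ * delta R (fin R (refl R j)) := by
    rw [delta_mul_scalar, ← refl_smul_rootF, ← smul_inv'']
    rfl
  rw [rootA, rootA, ← mul_assoc, h1]
  simp only [mul_assoc, mul_sub, sub_mul, mul_one, delta_mul, ← fin_mul, refl_mul_self,
    refl_conj]
  congr 1
  exact (mul_one _).symm

variable [R.IsReduced]

lemma rootA_mem (i : ι) : rootA i ∈ nilHecke b θ := by
  have key : ∀ i j, rootA i ∈ nilHecke b θ → rootA j ∈ nilHecke b θ →
      rootA (R.reflectionPerm j i) ∈ nilHecke b θ := by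
    intro i j hi hj
    have : delta R (fin R (refl R j)) ∈ nilHecke b θ := by
      rw [delta_refl]
      exact sub_mem (one_mem _) (mul_mem (scalarS_mem b θ _) hj)
    rw [rootA_conj]
    exact mul_mem (mul_mem this hi) this
  have simple : ∀ i ∈ b.support, rootA i ∈ nilHecke b θ := fun i hi =>
    simpleA_mem b θ (some ⟨i, hi⟩)
  exact b.induction_reflect i (fun i hi => key i i hi hi) simple
    (fun i j hi hj => key i j hi (simple j hj))

lemma delta_fin_mem (w : R.weylGroup) : delta R (fin R w) ∈ nilHecke b θ := by
  obtain ⟨w, hw⟩ := w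
  induction hw using RootPairing.weylGroup.induction with
  | mem i =>
    change delta R (fin R (refl R i)) ∈ _
    rw [delta_refl]
    exact sub_mem (one_mem _) (mul_mem (scalarS_mem b θ _) (rootA_mem b θ i))
  | one => exact one_mem _
  | mul x y hx hy h h' =>
    have e : (⟨x * y, mul_mem hx hy⟩ : R.weylGroup) = ⟨x, hx⟩ * ⟨y, hy⟩ := rfl
    rw [e, fin_mul, ← delta_mul]
    exact mul_mem h h'

/-! ### The homology of the adjoint affine Grassmannian and the map `j^ad` -/

variable (R)

/-- The localized equivariant homology `Frac(S)[P^∨]`: the group algebra of `P^∨`, on the classes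
of the torus fixed points `t_λ`, with the Pontryagin product. -/
abbrev LocHomology : Type _ := AddMonoidAlgebra (FracS R) (coweightLattice R)

/-- The map `a ↦ a · [pt]`, i.e. the projection `⨁ₓ Frac(S) δₓ → Frac(S)[P^∨]` sending
`f δ_{t_λ w}` to `f` times the class of the fixed point `t_λ`. -/
def proj : TwistedRing R →+ LocHomology R :=
  SkewMonoidAlgebra.liftNC (AddMonoidAlgebra.singleZeroRingHom (R := FracS R)).toAddMonoidHom
    (fun x => AddMonoidAlgebra.single (transPart R x) 1)

/-- The ring embedding `Frac(S)[P^∨] → ⨁ₓ Frac(S) δₓ` sending the class of the fixed point `t_λ`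
to `δ_{t_λ}`. -/
def locJ : LocHomology R →+* TwistedRing R :=
  AddMonoidAlgebra.liftNCRingHom (scalar R)
    ((SkewMonoidAlgebra.of (FracS R) (ExtAffWeyl R)).comp SemidirectProduct.inl)
    (fun f y => by
      change scalar R f * delta R (trans R y.toAdd) = delta R (trans R y.toAdd) * scalar R f
      rw [delta_mul_scalar]
      simp [trans, finPart])

lemma proj_single (x : ExtAffWeyl R) (f : FracS R) :
    proj R (SkewMonoidAlgebra.single x f) = AddMonoidAlgebra.single (transPart R x) f := by
  simp [proj]

lemma locJ_single (l : coweightLattice R) (f : FracS R) :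
    locJ R (AddMonoidAlgebra.single l f) = SkewMonoidAlgebra.single (trans R l) f := by
  rw [locJ, AddMonoidAlgebra.liftNCRingHom_single, single_eq]
  rfl

lemma proj_locJ (a : LocHomology R) : proj R (locJ R a) = a := by
  induction a using AddMonoidAlgebra.induction_linear with
  | zero => simp
  | add a b ha hb => rw [map_add, map_add, ha, hb]
  | single l f => rw [locJ_single, proj_single]; rfl

lemma proj_locJ_mul (a : LocHomology R) (z : TwistedRing R) :
    proj R (locJ R a * z) = a * proj R z := by
  induction a using AddMonoidAlgebra.induction_linear with
  | zero => simp
  | add a b ha hb => rw [map_add, add_mul, map_add, ha, hb, add_mul]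
  | single l f =>
    induction z using SkewMonoidAlgebra.induction_on' with
    | add z z' h h' => rw [mul_add, map_add, h, h', map_add, mul_add]
    | single x g =>
      rw [locJ_single, SkewMonoidAlgebra.single_mul_single, proj_single, proj_single,
        AddMonoidAlgebra.single_mul_single]
      have h1 : transPart R (trans R l * x) = l + transPart R x := by
        simp [trans, transPart]
      have h2 : trans R l • g = g := by simp [ext_smul_def, trans, finPart]
      rw [h1, h2]

lemma locJ_comm (a : LocHomology R) (f : FracS R) :
    scalar R f * locJ R a = locJ R a * scalar R f := by
  induction a using AddMonoidAlgebra.induction_linear with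
  | zero => simp
  | add a b ha hb => rw [map_add, add_mul, mul_add, ha, hb]
  | single l g =>
    rw [locJ_single, scalar_mul_single, scalar_apply, SkewMonoidAlgebra.single_mul_single]
    simp [ext_smul_def, trans, finPart, mul_comm]

lemma locJ_proj_scalar (f : FracS R) (z : TwistedRing R) :
    locJ R (proj R (scalar R f * z)) = scalar R f * locJ R (proj R z) := by
  induction z using SkewMonoidAlgebra.induction_on' with
  | add z z' h h' => simp only [mul_add, map_add, h, h']
  | single x g => simp only [scalar_mul_single, proj_single, locJ_single]

lemma locJ_proj_delta (x : ExtAffWeyl R) (z : TwistedRing R) :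
    locJ R (proj R (delta R x * z)) =
      delta R x * locJ R (proj R z) * delta R (fin R (finPart R x)⁻¹) := by
  induction z using SkewMonoidAlgebra.induction_on' with
  | add z z' h h' => simp only [mul_add, map_add, h, h', add_mul]
  | single y g =>
    simp only [delta, SkewMonoidAlgebra.single_mul_single, proj_single, locJ_single, one_mul,
      smul_one, mul_one]
    congr 1
    apply SemidirectProduct.ext
    · simp [trans, fin, finPart, transPart]
    · simp [trans, fin, finPart, transPart]

/-- Integrality of `j` for the operators `γ⁻¹ (1 - δ_x)`, `x` an affine reflection. -/
lemma locJ_proj_op (b : R.Base) (θ : ι) {γ : SymP R} {f : FracS R}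
    (hγ : algebraMap (SymP R) (FracS R) γ * f = 1) {x : ExtAffWeyl R} {u : R.weylGroup}
    (hu : (finPart R x)⁻¹ = u)
    (hA : scalar R f * (1 - delta R x) ∈ nilHecke b θ)
    (hB : scalar R f * (1 - delta R (fin R u)) ∈ nilHecke b θ)
    (z : TwistedRing R) (hz : locJ R (proj R z) ∈ nilHecke b θ) :
    locJ R (proj R (scalar R f * (1 - delta R x) * z)) ∈ nilHecke b θ := by
  set g := algebraMap (SymP R) (FracS R) γ with hg
  set A := scalar R f * (1 - delta R x) with hAdef
  set B := scalar R f * (1 - delta R (fin R u)) with hBdef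
  set w := locJ R (proj R z) with hw
  have hgg : scalar R g * scalar R f = 1 := by rw [← map_mul, hγ, map_one]
  have hgg' : scalar R f * scalar R g = 1 := by rw [← map_mul, mul_comm, hγ, map_one]
  have c1 : scalar R g * w = w * scalar R g := locJ_comm R _ _
  have dx : delta R x = 1 - scalar R g * A := by
    rw [hAdef, ← mul_assoc, hgg, one_mul, sub_sub_cancel]
  have dy : delta R (fin R u) = 1 - scalar R g * B := by
    rw [hBdef, ← mul_assoc, hgg, one_mul, sub_sub_cancel]
  have hsg : scalar R g ∈ nilHecke b θ := scalarS_mem b θ γ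
  have e : locJ R (proj R (A * z)) = A * w + w * B - A * scalar R g * w * B := by
    have e1 : A * z = scalar R f * (z - delta R x * z) := by
      rw [hAdef, mul_assoc, sub_mul, one_mul]
    rw [e1, locJ_proj_scalar, map_sub, map_sub, locJ_proj_delta, ← hw, hu, dx, dy]
    have e2 : w - (1 - scalar R g * A) * w * (1 - scalar R g * B) =
        scalar R g * (A * w + w * B - A * scalar R g * w * B) := by
      have e3 : scalar R g * (w * B) = w * (scalar R g * B) := by
        rw [← mul_assoc, c1, mul_assoc]
      have e4 : A * scalar R g * w * B = A * w * (scalar R g * B) := by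
        rw [mul_assoc A, c1]; simp only [mul_assoc]
      rw [mul_sub (scalar R g), mul_add (scalar R g), e3, e4]
      simp only [sub_mul, mul_sub, one_mul, mul_one, mul_assoc]
      abel
    rw [e2, ← mul_assoc, hgg', one_mul]
  rw [e]
  exact sub_mem (add_mem (mul_mem hA hz) (mul_mem hz hB))
    (mul_mem (mul_mem (mul_mem hA hsg) hz) hB)

lemma locJ_proj_simpleA (b : R.Base) (θ : ι) (i : Option b.support)
    (z : TwistedRing R) (hz : locJ R (proj R z) ∈ nilHecke b θ) :
    locJ R (proj R (simpleA b θ i * z)) ∈ nilHecke b θ := by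
  have hA := simpleA_mem b θ i
  cases i with
  | some i =>
    exact locJ_proj_op R b θ (γ := rootS R i) (mul_inv_cancel₀ (rootF_ne_zero _))
      (inv_eq_iff_mul_eq_one.2 (refl_mul_self _)) hA (rootA_mem b θ (i : ι)) z hz
  | none =>
    have hg : algebraMap (SymP R) (FracS R) (-rootS R θ) * (-(rootF R θ)⁻¹) = 1 := by
      rw [map_neg, neg_mul_neg]
      exact mul_inv_cancel₀ (rootF_ne_zero θ)
    have hu : (finPart R (simpleRefl b θ none))⁻¹ = refl R θ := by
      rw [inv_eq_iff_mul_eq_one, simpleRefl, map_mul]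
      change 1 * refl R θ * refl R θ = 1
      rw [one_mul, refl_mul_self]
    have hB : scalar R (-(rootF R θ)⁻¹) * (1 - delta R (fin R (refl R θ))) ∈
        nilHecke b θ := by
      have h1 : scalar R (-(rootF R θ)⁻¹) = scalarS R (-1) * scalar R (rootF R θ)⁻¹ := by
        rw [scalarS, RingHom.comp_apply, ← map_mul, map_neg (algebraMap _ _), map_one, neg_mul,
          one_mul]
      rw [h1, mul_assoc]
      exact mul_mem (scalarS_mem b θ _) (rootA_mem b θ θ)
    exact locJ_proj_op R b θ hg hu hA hB z hz

variable {R}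

/-- Integrality of `j`: it maps `Ã_aff · [pt]` into `Ã_aff`. -/
lemma locJ_proj_mem {a : TwistedRing R} (ha : a ∈ nilHecke b θ) :
    locJ R (proj R a) ∈ nilHecke b θ := by
  suffices h : ∀ z, locJ R (proj R z) ∈ nilHecke b θ →
      locJ R (proj R (a * z)) ∈ nilHecke b θ by
    have h1 := h 1 (by
      rw [← map_one (locJ R), proj_locJ, map_one]
      exact one_mem _)
    rwa [mul_one] at h1
  refine Subring.closure_induction (p := fun a _ => ∀ z, locJ R (proj R z) ∈ nilHecke b θ →
      locJ R (proj R (a * z)) ∈ nilHecke b θ) ?_ ?_ ?_ ?_ ?_ ?_ ha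
  · rintro a ((⟨s, rfl⟩ | ⟨i, rfl⟩) | ⟨τ, hτ, rfl⟩) z hz
    · change locJ R (proj R (scalar R _ * z)) ∈ _
      rw [locJ_proj_scalar]
      exact mul_mem (scalarS_mem b θ s) hz
    · exact locJ_proj_simpleA R b θ i z hz
    · rw [locJ_proj_delta]
      exact mul_mem (mul_mem (delta_mem_of_mem b θ hτ) hz) (delta_fin_mem b θ _)
  · intro z _; simp [zero_mem]
  · intro z hz; simpa using hz
  · intro a a' _ _ h h' z hz
    rw [add_mul, map_add, map_add]
    exact add_mem (h z hz) (h' z hz)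
  · intro a _ h z hz
    rw [show -a * z = -(a * z) from neg_mul a z, map_neg, map_neg]
    exact neg_mem (h z hz)
  · intro a a' _ _ h h' z hz
    rw [mul_assoc]
    exact h _ (h' z hz)

lemma locJ_scalar (f : FracS R) :
    locJ R (AddMonoidAlgebra.single 0 f) = scalar R f := by
  rw [locJ_single]; rfl

/-- An element of the twisted group ring commuting with `S` is supported on translations. -/
lemma finPart_eq_one_of_comm {z : TwistedRing R}
    (hz : ∀ s, scalarS R s * z = z * scalarS R s) (x : ExtAffWeyl R) (hx : z.coeff x ≠ 0) :
    finPart R x = 1 := by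
  apply Subtype.ext
  apply RootPairing.Equiv.weightHom_injective
  refine LinearEquiv.toLinearMap_injective ?_
  refine LinearMap.ext_on_range (v := R.root) (RootPairing.IsRootSystem.span_root_eq_top (P := R))
    fun i => ?_
  have h := congrArg (fun a => a.coeff x) (hz (rootS R i))
  have h1 : (scalarS R (rootS R i) * z).coeff x = rootF R i * z.coeff x :=
    SkewMonoidAlgebra.coeff_single_one_mul _ _ _
  have h2 : (z * scalarS R (rootS R i)).coeff x = z.coeff x * x • rootF R i :=
    SkewMonoidAlgebra.coeff_mul_single_one _ _ _
  simp only [h1, h2] at h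
  rw [mul_comm] at h
  have h3 : rootF R i = x • rootF R i := mul_left_cancel₀ hx h
  rw [ext_smul_def, rootF, weyl_smul_algebraMap, (FaithfulSMul.algebraMap_injective _ _).eq_iff,
    rootS, smul_ι, ι_injective.eq_iff] at h3
  exact (congrArg Subtype.val h3).symm

lemma eq_trans_of_finPart {x : ExtAffWeyl R} (h : finPart R x = 1) :
    trans R (transPart R x) = x :=
  SemidirectProduct.ext rfl h.symm

lemma locJ_proj_of_comm {z : TwistedRing R} (hz : ∀ s, scalarS R s * z = z * scalarS R s) :
    locJ R (proj R z) = z := by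
  have key := finPart_eq_one_of_comm hz
  clear hz
  have hsum : z = ∑ x ∈ z.support, SkewMonoidAlgebra.single x (z.coeff x) :=
    (SkewMonoidAlgebra.sum_single z).symm
  conv_rhs => rw [hsum]
  conv_lhs => rw [hsum]
  rw [map_sum, map_sum]
  refine Finset.sum_congr rfl fun x hx => ?_
  rw [proj_single, locJ_single, eq_trans_of_finPart
    (key x (SkewMonoidAlgebra.mem_support_iff.1 hx))]

/-- The equivariant homology `H_*^T(ΩK^ad)`, in its algebraic model: the cyclic `Ã_aff`-module
`Ã_aff · [pt]` generated by the class of the base point, which is an `S`-subalgebra of the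
localized homology. -/
def homologyAd : Subalgebra (SymP R) (LocHomology R) where
  carrier := {ξ | ∃ a ∈ nilHecke b θ, proj R a = ξ}
  mul_mem' := by
    rintro _ _ ⟨a, ha, rfl⟩ ⟨a', ha', rfl⟩
    exact ⟨locJ R (proj R a) * a', mul_mem (locJ_proj_mem b θ ha) ha', proj_locJ_mul R _ _⟩
  add_mem' := by
    rintro _ _ ⟨a, ha, rfl⟩ ⟨a', ha', rfl⟩
    exact ⟨a + a', add_mem ha ha', map_add _ _ _⟩
  algebraMap_mem' s := ⟨scalarS R s, scalarS_mem b θ s, by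
    change proj R (SkewMonoidAlgebra.single 1 _) = _
    rw [proj_single]; rfl⟩

/-- The Schubert class `ξ̃_w = Ã_w · [pt]`, for `w` of minimal length in `w W`. -/
def schubertClass (w : minReps b θ) : homologyAd b θ :=
  ⟨proj R (tildeA b θ w), tildeA b θ w, tildeA_mem b θ w, rfl⟩

/-- `Z_{Ã_aff}(S)` is an `S`-algebra. -/
instance : Algebra (SymP R) (centralizerS b θ) :=
  RingHom.toAlgebra' ((scalarS R).codRestrict (centralizerS b θ) fun s =>
    ⟨scalarS_mem b θ s, Subring.mem_centralizer_iff.2 (by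
      rintro _ ⟨s', rfl⟩
      rw [← map_mul, ← map_mul, mul_comm])⟩)
    fun s z => Subtype.ext (Subring.mem_centralizer_iff.1 z.2.2 _ ⟨s, rfl⟩)

/-- The isomorphism of `S`-algebras `j^ad : H_*^T(ΩK^ad) → Z_{Ã_aff}(S)`. It sends the class of
each torus fixed point `t_λ` to `δ_{t_λ}`. -/
def jAd : homologyAd b θ ≃ₐ[SymP R] centralizerS b θ :=
  AlgEquiv.ofBijective
    { toFun := fun ξ => ⟨locJ R ξ, by
        obtain ⟨_, a, ha, rfl⟩ := ξ
        refine ⟨locJ_proj_mem b θ ha, Subring.mem_centralizer_iff.2 ?_⟩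
        rintro _ ⟨s, rfl⟩
        exact locJ_comm R _ _⟩
      map_one' := Subtype.ext (map_one _)
      map_mul' := fun ξ ξ' => Subtype.ext (map_mul (locJ R) _ _)
      map_zero' := Subtype.ext (map_zero _)
      map_add' := fun ξ ξ' => Subtype.ext (map_add (locJ R) _ _)
      commutes' := fun s => Subtype.ext (locJ_scalar _) }
    ⟨fun ξ ξ' h => Subtype.ext (by
        have h' : locJ R ξ = locJ R ξ' := congrArg Subtype.val h
        rw [← proj_locJ R ξ, h', proj_locJ]),
      fun z => ⟨⟨proj R z, z, z.2.1, rfl⟩, Subtype.ext (locJ_proj_of_comm fun s =>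
        Subring.mem_centralizer_iff.1 z.2.2 _ ⟨s, rfl⟩)⟩⟩

end NilHecke

/-- A coweight is antidominant if it pairs nonpositively with every simple root. -/
def IsAntidominant (μ : coweightLattice R) : Prop :=
  ∀ i ∈ b.support, R.toLinearMap (R.root i) (μ : N) ≤ 0

end AffineNilHecke

end

/-!
Write `t_ν` for translations, `s_a` for the affine reflection in an affine root `a = α_i + k δ`,
and `Inv x` for the set of positive affine roots made negative by `x`, whose cardinality is the
length of `x` (`length_eq_invCard`). The map `j` inverts `z ↦ z · [pt]` on the centralizer of `S`
(`locJ_proj_of_comm`), so it is enough to show that the orbit sum `B = ∑ Ã_{t_ν}`, `ν ∈ W μ`,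

* has `B · [pt] = Ã_{t_μ} · [pt]`, and
* commutes with `S`.

For the first point, `μ` is the only antidominant coweight in its orbit; every other `t_ν` has a
right descent among the finite simple reflections, so `Ã_{t_ν}` ends in some `A_i`, `i ≠ 0`, which
kills `[pt]` (`proj_tildeA_trans`, `not_isAntidominant_smul`). Descents also show that an element
of `W` carrying `μ` to an antidominant coweight is a product of simple reflections fixing `μ`,
whence the description of the stabilizer (`mem_closure_of_isAntidominant_smul`).

The second point rests on the commutation formula (`tildeA_mul_weightT`)
`Ã_x v = x(v) Ã_x + ∑ ⟨v, a^∨⟩ Ã_{x s_a}`, over those `a ∈ Inv x` for which `x s_a` has length one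
less than `x`. Summed over the translations `t_ν`, which all have the same length
(`invCard_trans_smul`), the lower terms cancel in pairs: `(ν, a)` and `(s_a ν, -t_ν a)` give the
same group element and opposite coefficients (`sum_lowerTerms_eq_zero`).

That `Ã_x` does not depend on the reduced expression is proved together with the commutation
formula, by induction on the length (`indepUpTo`). The exchange property reduces two reduced words
of `x` ending in different letters `s`, `t` to two words in the dihedral group generated by `s` and
`t` (`exists_dihedral_decomposition`). By the commutation formula, the difference `C` of the two
products, for `u` in this dihedral group, satisfies `C v = u(v) C`; since `s` and `t` fix a common
point, this forces `C = c δ_u`. The augmentation `∑ f_x δ_x ↦ ∑ f_x` kills products ending in an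
`A_i`, so `c = 0` (`eq_zero_of_twisted_comm`, `wordA_dihedral_eq`).
-/

noncomputable section

namespace AffineNilHecke

open scoped Pointwise

/-! ### Affine roots -/

section AffineRoots

variable {ι V N : Type*} [AddCommGroup V] [Module ℝ V] [AddCommGroup N] [Module ℝ N]
  {R : RootPairing ι ℝ V N}

/-- The integer `⟨α_i, μ⟩` for a coweight `μ`. -/
def copairZ (μ : coweightLattice R) (i : ι) : ℤ := (μ.2 i).choose

lemma copairZ_spec (μ : coweightLattice R) (i : ι) :
    (copairZ μ i : ℝ) = R.toLinearMap (R.root i) (μ : N) := (μ.2 i).choose_spec.symm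

lemma finPart_trans_mul_fin (μ : coweightLattice R) (w : R.weylGroup) :
    finPart R (trans R μ * fin R w) = w := by
  simp [finPart, trans, fin]

lemma transPart_trans_mul_fin (μ : coweightLattice R) (w : R.weylGroup) :
    transPart R (trans R μ * fin R w) = μ := by
  simp [transPart, trans, fin]

/-- The value at `y` of the affine function `α_i + k δ`, where `δ` is the constant function `1`.
The pair `a = (i, k)` is the affine real root `α_i + k δ`. -/
def affEval (R : RootPairing ι ℝ V N) (a : ι × ℤ) (y : N) : ℝ :=
  R.toLinearMap (R.root a.1) y + a.2

/-- The action of the extended affine Weyl group on affine roots, contragredient to its action on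
the coweight space. -/
def affAct (x : ExtAffWeyl R) (a : ι × ℤ) : ι × ℤ :=
  (R.weylGroupToPerm (finPart R x) a.1,
    a.2 - copairZ (transPart R x) (R.weylGroupToPerm (finPart R x) a.1))

lemma smul_def (x : ExtAffWeyl R) (y : N) :
    x • y = coweightRep R (finPart R x) y + (transPart R x : N) := rfl

lemma affEval_affAct_smul (x : ExtAffWeyl R) (a : ι × ℤ) (y : N) :
    affEval R (affAct x a) (x • y) = affEval R a y := by
  have h := pairing_weyl R (finPart R x) (R.root a.1) y
  rw [RootPairing.weylGroup_apply_root] at h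
  simp only [affEval, affAct, smul_def, map_add, h]
  push_cast
  rw [copairZ_spec]
  ring

lemma affEval_affAct (x : ExtAffWeyl R) (a : ι × ℤ) (y : N) :
    affEval R (affAct x a) y = affEval R a (x⁻¹ • y) := by
  rw [← affEval_affAct_smul x a, smul_inv_smul]

lemma affEval_injective {a a' : ι × ℤ} (h : ∀ y, affEval R a y = affEval R a' y) : a = a' := by
  have h0 : a.2 = a'.2 := by
    have := h 0
    simp only [affEval, map_zero, zero_add] at this
    exact_mod_cast this
  refine Prod.ext (R.root.injective (R.toPerfPair.injective ?_)) h0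
  ext y
  have := h y
  simp only [affEval, h0] at this
  exact add_right_cancel this

lemma affAct_one (a : ι × ℤ) : affAct (1 : ExtAffWeyl R) a = a :=
  affEval_injective (R := R) fun y => by rw [affEval_affAct, inv_one, one_smul]

lemma affAct_mul (x x' : ExtAffWeyl R) (a : ι × ℤ) :
    affAct (x * x') a = affAct x (affAct x' a) :=
  affEval_injective (R := R) fun y => by simp only [affEval_affAct, mul_inv_rev, mul_smul]

lemma affAct_inv_affAct (x : ExtAffWeyl R) (a : ι × ℤ) : affAct x⁻¹ (affAct x a) = a := by
  rw [← affAct_mul, inv_mul_cancel, affAct_one]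

lemma affAct_affAct_inv (x : ExtAffWeyl R) (a : ι × ℤ) : affAct x (affAct x⁻¹ a) = a := by
  rw [← affAct_mul, mul_inv_cancel, affAct_one]

lemma affAct_injective (x : ExtAffWeyl R) : Function.Injective (affAct x) :=
  Function.LeftInverse.injective (affAct_inv_affAct x)

variable (R) in
/-- The opposite `-α_i - k δ` of an affine root. -/
def affNeg (a : ι × ℤ) : ι × ℤ := (R.reflectionPerm a.1 a.1, -a.2)

lemma root_negIdx (i : ι) : R.root (R.reflectionPerm i i) = -R.root i := by simp

lemma affEval_affNeg (a : ι × ℤ) (y : N) : affEval R (affNeg R a) y = -affEval R a y := by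
  simp [affEval, affNeg, add_comm]

lemma affNeg_affNeg (a : ι × ℤ) : affNeg R (affNeg R a) = a :=
  affEval_injective (R := R) fun y => by simp only [affEval_affNeg, neg_neg]

lemma affAct_affNeg (x : ExtAffWeyl R) (a : ι × ℤ) :
    affAct x (affNeg R a) = affNeg R (affAct x a) :=
  affEval_injective (R := R) fun y => by simp only [affEval_affAct, affEval_affNeg]

variable [R.IsCrystallographic]

/-- The affine reflection `s_a = t_{-k α_i^∨} s_i` in the affine root `a = α_i + k δ`. -/
def affRefl (R : RootPairing ι ℝ V N) [R.IsCrystallographic] (a : ι × ℤ) : ExtAffWeyl R :=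
  trans R (-a.2 • corootCoweight R a.1) * fin R (refl R a.1)

lemma coweightRep_refl (i : ι) (y : N) :
    coweightRep R (refl R i) y = y - R.toLinearMap (R.root i) y • R.coroot i := by
  have h : (refl R i)⁻¹ = refl R i := by
    apply Subtype.ext
    exact RootPairing.Equiv.reflection_inv R i
  change RootPairing.Equiv.coweightEquiv R R ((refl R i)⁻¹ : R.weylGroup).1 y = _
  rw [h]
  simp [refl, RootPairing.weylGroup.ofIdx, RootPairing.coreflection_apply]

lemma finPart_affRefl (a : ι × ℤ) : finPart R (affRefl R a) = refl R a.1 :=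
  finPart_trans_mul_fin _ _

lemma affRefl_smul (a : ι × ℤ) (y : N) :
    affRefl R a • y = y - affEval R a y • R.coroot a.1 := by
  have h : (transPart R (affRefl R a) : N) = (-a.2 : ℝ) • R.coroot a.1 := by
    have : transPart R (affRefl R a) = -a.2 • corootCoweight R a.1 :=
      transPart_trans_mul_fin _ _
    rw [this]
    simp only [neg_smul, Submodule.coe_neg, Submodule.coe_smul, corootCoweight, Int.cast_smul_eq_zsmul]
  rw [smul_def, finPart_affRefl, coweightRep_refl, h, affEval]
  module

lemma coweightRep_injective : Function.Injective (coweightRep R) := by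
  intro w w' h
  apply Subtype.ext
  apply RootPairing.Equiv.weightHom_injective
  ext v
  change w • v = w' • v
  apply R.toPerfPair.injective
  ext y
  change R.toLinearMap (w • v) y = R.toLinearMap (w' • v) y
  obtain ⟨y, rfl⟩ := (coweightRep R w).surjective y
  rw [pairing_weyl, h, pairing_weyl]

/-- The extended affine Weyl group acts faithfully on the coweight space. -/
lemma eq_of_forall_smul_eq {x x' : ExtAffWeyl R} (h : ∀ y : N, x • y = x' • y) : x = x' := by
  have h0 : (transPart R x : N) = transPart R x' := by
    simpa only [smul_def, map_zero, zero_add] using h 0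
  have h1 : finPart R x = finPart R x' := by
    refine coweightRep_injective (LinearEquiv.ext fun y => ?_)
    have := h y
    rwa [smul_def, smul_def, h0, add_left_inj] at this
  exact SemidirectProduct.ext (Subtype.ext h0) h1

lemma affRefl_affNeg (a : ι × ℤ) : affRefl R (affNeg R a) = affRefl R a := by
  refine eq_of_forall_smul_eq fun y => ?_
  rw [affRefl_smul, affRefl_smul, affEval_affNeg]
  simp [affNeg]

lemma affRefl_mul_self (a : ι × ℤ) : affRefl R a * affRefl R a = 1 := by
  refine eq_of_forall_smul_eq fun y => ?_
  rw [mul_smul, one_smul, affRefl_smul, affRefl_smul]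
  have : R.toLinearMap (R.root a.1) (R.coroot a.1) = 2 := R.root_coroot_two a.1
  simp only [affEval, map_sub, map_smul, this, smul_eq_mul]
  module

lemma affRefl_inv (a : ι × ℤ) : (affRefl R a)⁻¹ = affRefl R a :=
  inv_eq_of_mul_eq_one_left (affRefl_mul_self a)

lemma affAct_affRefl_self (a : ι × ℤ) : affAct (affRefl R a) a = affNeg R a := by
  refine affEval_injective (R := R) fun y => ?_
  have : R.toLinearMap (R.root a.1) (R.coroot a.1) = 2 := R.root_coroot_two a.1
  rw [affEval_affAct, affRefl_inv, affRefl_smul, affEval_affNeg]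
  simp only [affEval, map_sub, map_smul, this, smul_eq_mul]
  ring

lemma coweightRep_coroot (w : R.weylGroup) (i : ι) :
    coweightRep R w (R.coroot i) = R.coroot (R.weylGroupToPerm w i) := by
  have h := RootPairing.Hom.coroot_coweightMap_apply R R i (w⁻¹ : R.weylGroup).1.toHom
  have h' : (R.weylGroupToPerm w⁻¹).symm i = R.weylGroupToPerm w i := by
    rw [map_inv]
    rfl
  rw [← h']
  exact h

lemma affRefl_affAct (x : ExtAffWeyl R) (a : ι × ℤ) :
    affRefl R (affAct x a) = x * affRefl R a * x⁻¹ := by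
  refine eq_of_forall_smul_eq fun y => ?_
  obtain ⟨y, rfl⟩ := MulAction.surjective x y
  rw [affRefl_smul, affEval_affAct_smul, mul_smul, inv_smul_smul, mul_smul, affRefl_smul]
  simp only [smul_def, map_sub, map_smul, coweightRep_coroot, affAct]
  abel

end AffineRoots

/-! ### Positive affine roots and the fundamental alcove -/

section Positivity

variable {ι V N : Type*} [AddCommGroup V] [Module ℝ V] [AddCommGroup N] [Module ℝ N]
  {R : RootPairing ι ℝ V N}

/-- An affine root `α_i + k δ` is positive if `k > 0`, or `k = 0` and `α_i` is positive. -/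
def AffPos (b : R.Base) (a : ι × ℤ) : Prop := 0 < a.2 ∨ (a.2 = 0 ∧ b.IsPos a.1)

lemma height_negIdx (b : R.Base) (i : ι) :
    b.height (R.reflectionPerm i i) = -b.height i := b.height_reflectionPerm_self i

lemma affPos_affNeg_iff (b : R.Base) (a : ι × ℤ) : AffPos b (affNeg R a) ↔ ¬ AffPos b a := by
  have := b.height_ne_zero a.1
  simp only [AffPos, affNeg, RootPairing.Base.isPos_iff, height_negIdx]
  omega

variable [R.IsCrystallographic]

variable (b : R.Base) (θ : ι)

/-- The simple affine roots: the simple roots `α_i`, and `α_0 = δ - θ`. -/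
def simpleAff : Option b.support → ι × ℤ
  | some i => (i, 0)
  | none => (R.reflectionPerm θ θ, 1)

lemma affPos_simpleAff (s : Option b.support) : AffPos b (simpleAff b θ s) := by
  cases s with
  | some i => exact Or.inr ⟨rfl, RootPairing.Base.isPos_of_mem_support i.2⟩
  | none => exact Or.inl Int.one_pos

lemma simpleRefl_eq (s : Option b.support) :
    simpleRefl b θ s = affRefl R (simpleAff b θ s) := by
  cases s with
  | some i =>
    simp only [simpleRefl, simpleAff, affRefl, neg_zero, zero_smul]
    simp [trans]
  | none =>
    rw [simpleAff, show ((R.reflectionPerm θ θ, 1) : ι × ℤ) = affNeg R (θ, -1) from rfl,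
      affRefl_affNeg]
    simp [simpleRefl, affRefl]

lemma mem_alcove_iff (y : N) : y ∈ alcove b θ ↔ ∀ s, 0 ≤ affEval R (simpleAff b θ s) y := by
  constructor
  · rintro ⟨h1, h2⟩ (_ | i)
    · simpa [affEval, simpleAff] using h2
    · simpa [affEval, simpleAff] using h1 i i.2
  · intro h
    refine ⟨fun i hi => ?_, ?_⟩
    · simpa [affEval, simpleAff] using h (some ⟨i, hi⟩)
    · simpa [affEval, simpleAff] using h none

lemma root_nonneg [Finite ι] [R.IsReduced] {y : N}
    (hy : ∀ i ∈ b.support, 0 ≤ R.toLinearMap (R.root i) y) {i : ι} (hi : b.IsPos i) :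
    0 ≤ R.toLinearMap (R.root i) y := by
  refine hi.induction_on_add hy fun i j k hk h hj => ?_
  rw [hk, map_add, LinearMap.add_apply]
  exact add_nonneg h (hy j hj)

variable {b θ}

lemma root_le_highestRoot (hθ : IsHighestRoot b θ) {y : N}
    (hy : ∀ i ∈ b.support, 0 ≤ R.toLinearMap (R.root i) y) (i : ι) :
    R.toLinearMap (R.root i) y ≤ R.toLinearMap (R.root θ) y := by
  suffices h : ∀ v ∈ AddSubmonoid.closure (R.root '' b.support), 0 ≤ R.toLinearMap v y by
    have := h _ (hθ i)
    rwa [map_sub, LinearMap.sub_apply, sub_nonneg] at this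
  intro v hv
  induction hv using AddSubmonoid.closure_induction with
  | mem v hv =>
    obtain ⟨i, hi, rfl⟩ := hv
    exact hy i hi
  | zero => simp
  | add v w _ _ h h' =>
    rw [map_add, LinearMap.add_apply]
    exact add_nonneg h h'

/-- Positive affine roots are nonnegative on the fundamental alcove. -/
lemma affEval_nonneg_of_affPos [Finite ι] [R.IsReduced] (hθ : IsHighestRoot b θ) {y : N}
    (hy : y ∈ alcove b θ)
    {a : ι × ℤ} (ha : AffPos b a) : 0 ≤ affEval R a y := by
  obtain ⟨i, k⟩ := a
  rcases ha with ha | ⟨h0, hi⟩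
  · have h1 := root_le_highestRoot hθ hy.1 (R.reflectionPerm i i)
    rw [root_negIdx, map_neg, LinearMap.neg_apply] at h1
    have h2 := hy.2
    have h3 : (1 : ℝ) ≤ k := by exact_mod_cast ha
    simp only [affEval]
    linarith
  · simp only at h0 hi
    simp only [affEval, h0, Int.cast_zero, add_zero]
    exact root_nonneg b hy.1 hi

/-- A point of the coweight space on which the simple roots take prescribed values. -/
lemma exists_simple_values [R.IsRootSystem] (b : R.Base) (c : ι → ℝ) :
    ∃ y : N, ∀ i ∈ b.support, R.toLinearMap (R.root i) y = c i := by
  let f : Module.Dual ℝ V := b.toWeightBasis.constr ℝ fun i => c i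
  refine ⟨R.flip.toPerfPair.symm f, fun i hi => ?_⟩
  have h1 : R.toLinearMap (R.root i) (R.flip.toPerfPair.symm f) =
      R.flip.toPerfPair (R.flip.toPerfPair.symm f) (R.root i) := rfl
  rw [h1, LinearEquiv.apply_symm_apply]
  have h2 : R.root i = b.toWeightBasis ⟨i, hi⟩ := by simp
  rw [h2, Module.Basis.constr_basis]

lemma root_apply_eq_height (b : R.Base) {y : N} {c : ℝ}
    (hy : ∀ i ∈ b.support, R.toLinearMap (R.root i) y = c) (i : ι) :
    R.toLinearMap (R.root i) y = b.height i * c := by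
  obtain ⟨f, -, -, hf⟩ := b.exists_root_eq_sum_int i
  rw [RootPairing.Base.height_eq_sum hf, hf, map_sum, LinearMap.sum_apply, Int.cast_sum,
    Finset.sum_mul]
  refine Finset.sum_congr rfl fun j hj => ?_
  rw [map_zsmul, LinearMap.smul_apply, hy j hj, zsmul_eq_mul]

/-- The highest root has the largest height. -/
lemma height_le_highestRoot [R.IsRootSystem] (hθ : IsHighestRoot b θ) (i : ι) :
    b.height i ≤ b.height θ := by
  obtain ⟨y, hy⟩ := exists_simple_values b fun _ => 1
  have h := root_le_highestRoot hθ (fun i hi => by rw [hy i hi]; exact zero_le_one) i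
  rw [root_apply_eq_height b hy, root_apply_eq_height b hy, mul_one, mul_one] at h
  exact_mod_cast h

lemma height_highestRoot_pos [R.IsRootSystem] (hθ : IsHighestRoot b θ) : 0 < b.height θ := by
  have h1 := height_le_highestRoot hθ (R.reflectionPerm θ θ)
  rw [height_negIdx] at h1
  have := b.height_ne_zero θ
  omega

/-- The highest root is the only root of its height. -/
lemma eq_highestRoot_of_height_eq [R.IsRootSystem] (hθ : IsHighestRoot b θ) {i : ι}
    (hi : b.height i = b.height θ) : i = θ := by
  obtain ⟨y, hy⟩ := exists_simple_values b fun _ => 1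
  have key : ∀ v ∈ AddSubmonoid.closure (R.root '' b.support),
      v = 0 ∨ 0 < R.toLinearMap v y := by
    intro v hv
    induction hv using AddSubmonoid.closure_induction with
    | mem v hv =>
      obtain ⟨i, hi, rfl⟩ := hv
      right
      rw [hy i hi]
      exact one_pos
    | zero => exact Or.inl rfl
    | add v w _ _ h h' =>
      rcases h with rfl | h
      · rwa [zero_add]
      · right
        rw [map_add, LinearMap.add_apply]
        rcases h' with rfl | h'
        · simpa using h
        · exact add_pos h h'
  rcases key _ (hθ i) with h | h
  · exact (R.root.injective (sub_eq_zero.1 h)).symm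
  · rw [map_sub, LinearMap.sub_apply, root_apply_eq_height b hy, root_apply_eq_height b hy, hi,
      sub_self] at h
    exact absurd h (lt_irrefl _)

/-- A point in the interior of the fundamental alcove: an affine root is positive if and only if
it is positive at this point. -/
lemma exists_regular_point [R.IsRootSystem] (hθ : IsHighestRoot b θ) :
    ∃ p ∈ alcove b θ, ∀ a : ι × ℤ, AffPos b a ↔ 0 < affEval R a p := by
  have hpos := height_highestRoot_pos hθ
  set h : ℤ := b.height θ with hh
  have hpos' : (0 : ℝ) < h + 1 := by exact_mod_cast (by omega : 0 < h + 1)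
  obtain ⟨p, hp⟩ := exists_simple_values b fun _ => ((h : ℝ) + 1)⁻¹
  have hv := root_apply_eq_height b hp
  refine ⟨p, ⟨fun i hi => by rw [hp i hi]; positivity, ?_⟩, fun a => ?_⟩
  · rw [hv, ← hh, ← div_eq_mul_inv, div_le_one hpos']
    linarith
  · have e : affEval R a p = (b.height a.1 + a.2 * (h + 1) : ℤ) / ((h : ℝ) + 1) := by
      rw [affEval, hv]
      push_cast
      field_simp
    rw [e, div_pos_iff_of_pos_right hpos', Int.cast_pos]
    have h1 := height_le_highestRoot hθ a.1
    have h2 := height_le_highestRoot hθ (R.reflectionPerm a.1 a.1)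
    rw [height_negIdx] at h2
    rw [← hh] at h1 h2
    simp only [AffPos, RootPairing.Base.isPos_iff]
    constructor
    · rintro (h3 | ⟨h3, h4⟩)
      · nlinarith
      · rw [h3]; omega
    · intro h3
      by_contra! h4
      obtain ⟨h4, h5⟩ := h4
      rcases h4.lt_or_eq with h6 | h6
      · nlinarith
      · have := h5 h6
        rw [h6] at h3
        omega

end Positivity

/-! ### Inversions and length -/

section Inversions

variable {ι V N : Type*} [AddCommGroup V] [Module ℝ V] [AddCommGroup N] [Module ℝ N]
  {R : RootPairing ι ℝ V N} [R.IsCrystallographic]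

lemma affAct_affRefl (c a : ι × ℤ) :
    affAct (affRefl R c) a = (R.reflectionPerm c.1 a.1, a.2 - c.2 * R.pairingIn ℤ a.1 c.1) := by
  refine affEval_injective (R := R) fun y => ?_
  have h1 : R.toLinearMap (R.root a.1) (R.coroot c.1) = (R.pairingIn ℤ a.1 c.1 : ℝ) := by
    rw [RootPairing.root_coroot_eq_pairing]
    exact (R.algebraMap_pairingIn ℤ a.1 c.1).symm
  rw [affEval_affAct, affRefl_inv, affRefl_smul]
  simp only [affEval, RootPairing.root_reflectionPerm, RootPairing.reflection_apply, map_sub,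
    map_smul, LinearMap.sub_apply, LinearMap.smul_apply, h1, smul_eq_mul]
  have h2 : R.toLinearMap.flip (R.coroot c.1) (R.root a.1) = (R.pairingIn ℤ a.1 c.1 : ℝ) := h1
  rw [RootPairing.coroot', h2]
  push_cast
  ring

variable (b : R.Base) (θ : ι)

/-- The affine inversions of `x`: the positive affine roots that `x` makes negative. -/
def inversions (x : ExtAffWeyl R) : Set (ι × ℤ) := {a | AffPos b a ∧ ¬ AffPos b (affAct x a)}

lemma inversions_finite [Finite ι] (x : ExtAffWeyl R) : (inversions b x).Finite := by
  let B : ι × ℤ → Prop := fun a =>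
    a.2 ∈ Set.Icc 0 (copairZ (transPart R x) (R.weylGroupToPerm (finPart R x) a.1))
  have h : {a | B a}.Finite := by
    have : {a | B a} = ⋃ i : ι, (fun k : ℤ => (i, k)) ''
        Set.Icc 0 (copairZ (transPart R x) (R.weylGroupToPerm (finPart R x) i)) := by
      ext ⟨i, k⟩
      simp [B]
    rw [this]
    exact Set.finite_iUnion fun i => (Set.finite_Icc _ _).image _
  refine h.subset fun a ha => ?_
  obtain ⟨h1, h2⟩ := ha
  simp only [AffPos, affAct, not_or] at h1 h2
  simp only [Set.mem_ofPred_eq, B, Set.mem_Icc]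
  omega

/-- The number of affine inversions of `x`. -/
def invCard (x : ExtAffWeyl R) : ℕ := (inversions b x).ncard

variable {b θ} [Finite ι] [R.IsReduced] [R.IsRootSystem] (hθ : IsHighestRoot b θ)

lemma affAct_simpleRefl_self (s : Option b.support) :
    affAct (simpleRefl b θ s) (simpleAff b θ s) = affNeg R (simpleAff b θ s) := by
  rw [simpleRefl_eq, affAct_affRefl_self]

lemma simpleRefl_mul_self (s : Option b.support) :
    simpleRefl b θ s * simpleRefl b θ s = 1 := by
  rw [simpleRefl_eq, affRefl_mul_self]

lemma simpleRefl_inv (s : Option b.support) : (simpleRefl b θ s)⁻¹ = simpleRefl b θ s := by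
  rw [simpleRefl_eq, affRefl_inv]

lemma affAct_simpleRefl_affAct (s : Option b.support) (a : ι × ℤ) :
    affAct (simpleRefl b θ s) (affAct (simpleRefl b θ s) a) = a := by
  rw [← affAct_mul, simpleRefl_mul_self, affAct_one]

include hθ

/-- A simple affine reflection permutes the positive affine roots other than its own root. -/
lemma affPos_affAct_simpleRefl (s : Option b.support) {a : ι × ℤ} (ha : AffPos b a)
    (hs : a ≠ simpleAff b θ s) : AffPos b (affAct (simpleRefl b θ s) a) := by
  obtain ⟨j, k⟩ := a
  cases s with
  | some i =>
    rw [simpleRefl_eq, simpleAff, affAct_affRefl]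
    rcases ha with ha | ⟨h0, hj⟩
    · left
      simpa using ha
    · simp only at h0 hj
      refine Or.inr ⟨by simp [h0], hj.reflectionPerm i.2 ?_⟩
      rintro rfl
      exact hs (by rw [h0]; rfl)
  | none =>
    have e : simpleRefl b θ none = affRefl R (θ, -1) := by
      rw [← affRefl_affNeg]
      exact simpleRefl_eq b θ none
    rw [e, affAct_affRefl]
    set p := R.pairingIn ℤ j θ with hp
    have hH := height_highestRoot_pos hθ
    have hr : R.root (R.reflectionPerm θ j) = R.root j + (-p) • R.root θ := by
      rw [RootPairing.root_reflectionPerm, neg_smul, RootPairing.reflection_apply_root' ℤ,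
        sub_eq_add_neg]
    have h1 : b.height (R.reflectionPerm θ j) = b.height j + (-p) * b.height θ := by
      rw [b.height_add_zsmul hr, smul_eq_mul]
    have h2 := height_le_highestRoot hθ (R.reflectionPerm θ j)
    have h3 := height_le_highestRoot hθ j
    have h4 := height_le_highestRoot hθ (R.reflectionPerm j j)
    have h4' := height_le_highestRoot hθ (R.reflectionPerm (R.reflectionPerm θ j) (R.reflectionPerm θ j))
    have h5 := b.height_ne_zero j
    have h6 := b.height_ne_zero (R.reflectionPerm θ j)
    rw [height_negIdx] at h4 h4'
    have hneg : k = 1 → b.height j ≠ -b.height θ := by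
      rintro rfl h
      apply hs
      have : R.reflectionPerm j j = θ :=
        eq_highestRoot_of_height_eq hθ (by rw [height_negIdx, h, neg_neg])
      simp only [simpleAff, Prod.mk.injEq, and_true]
      apply R.root.injective
      rw [root_negIdx, ← this, root_negIdx, neg_neg]
    simp only [AffPos, RootPairing.Base.isPos_iff] at ha ⊢
    rw [h1] at h2 h4' h6 ⊢
    -- comparing heights bounds the pairing with the highest root
    have p1 : p ≤ 2 := by nlinarith
    have p2 : -2 ≤ p := by nlinarith
    clear_value p
    interval_cases p <;> omega

lemma inversions_mul_simpleRefl {x : ExtAffWeyl R} {s : Option b.support}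
    (h : AffPos b (affAct x (simpleAff b θ s))) :
    inversions b (x * simpleRefl b θ s) =
      insert (simpleAff b θ s) (affAct (simpleRefl b θ s) '' inversions b x) := by
  ext a
  rw [Set.mem_insert_iff]
  constructor
  · rintro ⟨h1, h2⟩
    rw [or_iff_not_imp_left]
    intro h3
    rw [affAct_mul] at h2
    exact ⟨_, ⟨affPos_affAct_simpleRefl hθ s h1 h3, h2⟩, affAct_simpleRefl_affAct s a⟩
  · rintro (rfl | ⟨a, ⟨h1, h2⟩, rfl⟩)
    · refine ⟨affPos_simpleAff b θ s, ?_⟩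
      rwa [affAct_mul, affAct_simpleRefl_self, affAct_affNeg, affPos_affNeg_iff, not_not]
    · refine ⟨affPos_affAct_simpleRefl hθ s h1 ?_, ?_⟩
      · rintro rfl
        exact h2 h
      · rwa [affAct_mul, affAct_simpleRefl_affAct]

omit hθ in
lemma simpleAff_notMem_image (x : ExtAffWeyl R) (s : Option b.support) :
    simpleAff b θ s ∉ affAct (simpleRefl b θ s) '' inversions b x := by
  rintro ⟨a, ⟨h1, -⟩, h2⟩
  have : a = affNeg R (simpleAff b θ s) := by
    rw [← affAct_simpleRefl_self, ← h2, affAct_simpleRefl_affAct]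
  rw [this, affPos_affNeg_iff] at h1
  exact h1 (affPos_simpleAff b θ s)

lemma invCard_mul_simpleRefl {x : ExtAffWeyl R} {s : Option b.support}
    (h : AffPos b (affAct x (simpleAff b θ s))) :
    invCard b (x * simpleRefl b θ s) = invCard b x + 1 := by
  rw [invCard, inversions_mul_simpleRefl hθ h, Set.ncard_insert_of_notMem
    (simpleAff_notMem_image x s) ((inversions_finite b x).image _),
    Set.ncard_image_of_injective _ (affAct_injective _), invCard]

lemma invCard_mul_simpleRefl_of_neg {x : ExtAffWeyl R} {s : Option b.support}
    (h : ¬ AffPos b (affAct x (simpleAff b θ s))) :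
    invCard b (x * simpleRefl b θ s) + 1 = invCard b x := by
  have h' : AffPos b (affAct (x * simpleRefl b θ s) (simpleAff b θ s)) := by
    rwa [affAct_mul, affAct_simpleRefl_self, affAct_affNeg, affPos_affNeg_iff]
  have := invCard_mul_simpleRefl hθ h'
  rw [mul_assoc, simpleRefl_mul_self, mul_one] at this
  exact this.symm

/-- An element of positive length has a right descent. -/
lemma exists_descent {x : ExtAffWeyl R} (h : invCard b x ≠ 0) :
    ∃ s, ¬ AffPos b (affAct x (simpleAff b θ s)) := by
  by_contra! hs
  refine h ?_
  rw [invCard, Set.ncard_eq_zero (inversions_finite b x), Set.eq_empty_iff_forall_notMem]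
  rintro a ⟨h1, h2⟩
  obtain ⟨p, -, hp⟩ := exists_regular_point hθ
  have hx : x⁻¹ • p ∈ alcove b θ := by
    rw [mem_alcove_iff]
    intro s
    rw [← affEval_affAct]
    exact ((hp _).1 (hs s)).le
  have h3 := affEval_nonneg_of_affPos hθ hx h1
  rw [← affEval_affAct] at h3
  rw [← affPos_affNeg_iff, hp, affEval_affNeg] at h2
  linarith

lemma affPos_affAct_of_mem_alcoveStabilizer {τ : ExtAffWeyl R} (hτ : τ ∈ alcoveStabilizer b θ)
    {a : ι × ℤ} (ha : AffPos b a) : AffPos b (affAct τ a) := by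
  obtain ⟨p, hpA, hp⟩ := exists_regular_point hθ
  have h1 : τ⁻¹ • p ∈ alcove b θ := by
    have := inv_mem hτ
    rw [alcoveStabilizer, MulAction.mem_stabilizer_iff] at this
    rw [← this]
    exact Set.smul_mem_smul_set hpA
  have h2 := affEval_nonneg_of_affPos hθ h1 ha
  rw [← affEval_affAct] at h2
  by_contra h3
  rw [← affPos_affNeg_iff, hp, affEval_affNeg] at h3
  linarith

lemma affPos_affAct_stabilizer_iff {τ : ExtAffWeyl R} (hτ : τ ∈ alcoveStabilizer b θ)
    (a : ι × ℤ) : AffPos b (affAct τ a) ↔ AffPos b a := by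
  refine ⟨fun h => ?_, affPos_affAct_of_mem_alcoveStabilizer hθ hτ⟩
  have := affPos_affAct_of_mem_alcoveStabilizer hθ (inv_mem hτ) h
  rwa [affAct_inv_affAct] at this

lemma smul_mem_alcove {x : ExtAffWeyl R} (h : ∀ a, AffPos b a → AffPos b (affAct x⁻¹ a)) {y : N}
    (hy : y ∈ alcove b θ) : x • y ∈ alcove b θ := by
  rw [mem_alcove_iff]
  intro s
  have := affEval_nonneg_of_affPos hθ hy (h _ (affPos_simpleAff b θ s))
  rwa [affEval_affAct, inv_inv] at this

/-- The elements without inversions are those stabilizing the fundamental alcove. -/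
lemma mem_alcoveStabilizer_iff {x : ExtAffWeyl R} :
    x ∈ alcoveStabilizer b θ ↔ invCard b x = 0 := by
  rw [invCard, Set.ncard_eq_zero (inversions_finite b x), Set.eq_empty_iff_forall_notMem]
  constructor
  · rintro hx a ⟨h1, h2⟩
    exact h2 (affPos_affAct_of_mem_alcoveStabilizer hθ hx h1)
  · intro h
    have h1 : ∀ a, AffPos b a → AffPos b (affAct x a) := fun a ha => by
      by_contra h2
      exact h a ⟨ha, h2⟩
    have h2 : ∀ a, AffPos b a → AffPos b (affAct x⁻¹ a) := fun a ha => by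
      by_contra h3
      rw [← affPos_affNeg_iff, ← affAct_affNeg] at h3
      have := h1 _ h3
      rw [affAct_affAct_inv, affPos_affNeg_iff] at this
      exact this ha
    rw [alcoveStabilizer, MulAction.mem_stabilizer_iff]
    refine subset_antisymm ?_ fun y hy => ?_
    · rintro _ ⟨y, hy, rfl⟩
      exact smul_mem_alcove hθ h2 hy
    · rw [Set.mem_smul_set_iff_inv_smul_mem]
      exact smul_mem_alcove hθ (by rwa [inv_inv]) hy

end Inversions

/-! ### Words in the simple affine reflections and the exchange property -/

section Words

variable {ι V N : Type*} [AddCommGroup V] [Module ℝ V] [AddCommGroup N] [Module ℝ N]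
  {R : RootPairing ι ℝ V N} [R.IsCrystallographic] {b : R.Base} {θ : ι}

variable (b θ) in
/-- The product of a word in the simple affine reflections. -/
def wordProd (L : List (Option b.support)) : ExtAffWeyl R := (L.map (simpleRefl b θ)).prod

@[simp] lemma wordProd_nil : wordProd b θ [] = 1 := rfl

lemma wordProd_cons (s : Option b.support) (L : List (Option b.support)) :
    wordProd b θ (s :: L) = simpleRefl b θ s * wordProd b θ L := by
  simp [wordProd]

lemma wordProd_append (L L' : List (Option b.support)) :
    wordProd b θ (L ++ L') = wordProd b θ L * wordProd b θ L' := by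
  simp [wordProd]

lemma wordProd_concat (L : List (Option b.support)) (s : Option b.support) :
    wordProd b θ (L ++ [s]) = wordProd b θ L * simpleRefl b θ s := by
  simp [wordProd]

variable [Finite ι] [R.IsReduced] [R.IsRootSystem] (hθ : IsHighestRoot b θ)

include hθ

/-- The exchange property: if a word makes a positive affine root negative, then multiplying by
the reflection in this root amounts to deleting a letter. -/
lemma exists_eraseIdx_of_neg (L : List (Option b.support)) {a : ι × ℤ} (ha : AffPos b a)
    (h : ¬ AffPos b (affAct (wordProd b θ L) a)) :
    ∃ k < L.length, wordProd b θ L * affRefl R a = wordProd b θ (L.eraseIdx k) := by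
  induction L with
  | nil =>
    rw [wordProd_nil, affAct_one] at h
    exact absurd ha h
  | cons s L ih =>
    by_cases h1 : AffPos b (affAct (wordProd b θ L) a)
    · refine ⟨0, Nat.succ_pos _, ?_⟩
      rw [wordProd_cons, affAct_mul] at h
      -- the root that changes sign under `s` is the root of `s`
      have h2 : affAct (wordProd b θ L) a = simpleAff b θ s := by
        by_contra h2
        exact h (affPos_affAct_simpleRefl hθ s h1 h2)
      have h3 := affRefl_affAct (wordProd b θ L) a
      rw [h2, ← simpleRefl_eq] at h3
      rw [wordProd_cons, List.eraseIdx_zero, List.tail_cons, h3]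
      simp only [mul_assoc, inv_mul_cancel_left, affRefl_mul_self, mul_one]
    · obtain ⟨k, hk, e⟩ := ih h1
      refine ⟨k + 1, Nat.succ_lt_succ hk, ?_⟩
      rw [wordProd_cons, mul_assoc, e, List.eraseIdx_cons_succ, wordProd_cons]

lemma invCard_mul_simpleRefl_le (x : ExtAffWeyl R) (s : Option b.support) :
    invCard b (x * simpleRefl b θ s) ≤ invCard b x + 1 := by
  by_cases h : AffPos b (affAct x (simpleAff b θ s))
  · exact (invCard_mul_simpleRefl hθ h).le
  · have := invCard_mul_simpleRefl_of_neg hθ h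
    omega

lemma invCard_mul_wordProd_le (x : ExtAffWeyl R) (L : List (Option b.support)) :
    invCard b (x * wordProd b θ L) ≤ invCard b x + L.length := by
  induction L using List.reverseRecOn with
  | nil => simp
  | append_singleton L s ih =>
    rw [wordProd_concat, ← mul_assoc, List.length_append, List.length_singleton]
    have := invCard_mul_simpleRefl_le hθ (x * wordProd b θ L) s
    omega

lemma invCard_eq_zero_of_mem {τ : ExtAffWeyl R} (hτ : τ ∈ alcoveStabilizer b θ) :
    invCard b τ = 0 := (mem_alcoveStabilizer_iff hθ).1 hτ

lemma invCard_le_of_isExpression {x : ExtAffWeyl R}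
    {e : alcoveStabilizer b θ × List (Option b.support)} (he : IsExpression b θ x e) :
    invCard b x ≤ e.2.length := by
  have h := invCard_mul_wordProd_le hθ (e.1 : ExtAffWeyl R) e.2
  rw [invCard_eq_zero_of_mem hθ e.1.2, zero_add] at h
  rwa [he]

lemma exists_isExpression (x : ExtAffWeyl R) :
    ∃ e, IsExpression b θ x e ∧ e.2.length = invCard b x := by
  induction hn : invCard b x generalizing x with
  | zero =>
    exact ⟨(⟨x, (mem_alcoveStabilizer_iff hθ).2 hn⟩, []), by simp [IsExpression], rfl⟩
  | succ n ih =>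
    obtain ⟨s, hs⟩ := exists_descent hθ (x := x) (by omega)
    have h1 := invCard_mul_simpleRefl_of_neg hθ hs
    obtain ⟨e, he, hl⟩ := ih (x * simpleRefl b θ s) (by omega)
    refine ⟨(e.1, e.2 ++ [s]), ?_, by simp [hl]⟩
    change x = (e.1 : ExtAffWeyl R) * wordProd b θ (e.2 ++ [s])
    rw [wordProd_concat, ← mul_assoc]
    change _ = (e.1 : ExtAffWeyl R) * (e.2.map (simpleRefl b θ)).prod * _
    rw [← he, mul_assoc, simpleRefl_mul_self, mul_one]

/-- The length is the number of affine inversions. -/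
lemma length_eq_invCard (x : ExtAffWeyl R) : length b θ x = invCard b x := by
  obtain ⟨e, he, hl⟩ := exists_isExpression hθ x
  refine le_antisymm (Nat.sInf_le ⟨e, he, hl⟩) (le_csInf ⟨_, e, he, hl⟩ ?_)
  rintro _ ⟨e', he', rfl⟩
  exact invCard_le_of_isExpression hθ he'

lemma isReducedExpression_iff {x : ExtAffWeyl R}
    {e : alcoveStabilizer b θ × List (Option b.support)} :
    IsReducedExpression b θ x e ↔
      x = e.1 * wordProd b θ e.2 ∧ e.2.length = invCard b x := by
  rw [IsReducedExpression, length_eq_invCard hθ]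
  rfl

lemma exists_isReducedExpression (x : ExtAffWeyl R) : ∃ e, IsReducedExpression b θ x e := by
  obtain ⟨e, he⟩ := exists_isExpression hθ x
  exact ⟨e, (isReducedExpression_iff hθ).2 he⟩

lemma invCard_mul_affRefl_lt {x : ExtAffWeyl R} {a : ι × ℤ} (ha : a ∈ inversions b x) :
    invCard b (x * affRefl R a) < invCard b x := by
  obtain ⟨e, he, hl⟩ := exists_isExpression hθ x
  have he' : x = e.1 * wordProd b θ e.2 := he
  have h := ha.2
  rw [he', affAct_mul, affPos_affAct_stabilizer_iff hθ e.1.2] at h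
  obtain ⟨k, hk, hL⟩ := exists_eraseIdx_of_neg hθ e.2 ha.1 h
  have h1 := invCard_le_of_isExpression hθ (x := x * affRefl R a) (e := (e.1, e.2.eraseIdx k))
    (by change _ = (e.1 : ExtAffWeyl R) * wordProd b θ _; rw [← hL, ← mul_assoc, ← he'])
  rw [List.length_eraseIdx_of_lt hk] at h1
  omega

omit hθ [R.IsReduced] [R.IsRootSystem] in
lemma invCard_mul_le (x y : ExtAffWeyl R) : invCard b (x * y) ≤ invCard b x + invCard b y := by
  have h : inversions b (x * y) ⊆ affAct y⁻¹ '' inversions b x ∪ inversions b y := by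
    rintro a ⟨h1, h2⟩
    rw [affAct_mul] at h2
    by_cases h3 : AffPos b (affAct y a)
    · exact Or.inl ⟨_, ⟨h3, h2⟩, affAct_inv_affAct y a⟩
    · exact Or.inr ⟨h1, h3⟩
  refine (Set.ncard_le_ncard h
    (((inversions_finite b x).image _).union (inversions_finite b y))).trans ?_
  refine (Set.ncard_union_le _ _).trans ?_
  rw [Set.ncard_image_of_injective _ (affAct_injective _)]
  rfl

end Words

/-! ### The elements `A_i` in the twisted group ring -/

section Twisted

variable {ι V N : Type*} [AddCommGroup V] [Module ℝ V] [AddCommGroup N] [Module ℝ N]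
  {R : RootPairing ι ℝ V N} [R.IsCrystallographic] {b : R.Base} {θ : ι}

lemma pairZ_smul (w : R.weylGroup) (v : weightLattice R) (i : ι) :
    pairZ R (w • v) (R.weylGroupToPerm w i) = pairZ R v i := by
  have : (pairZ R (w • v) (R.weylGroupToPerm w i) : ℝ) = pairZ R v i := by
    rw [pairZ_spec, pairZ_spec, ← coweightRep_coroot, coe_smul_weight, pairing_weyl]
  exact_mod_cast this

lemma pairZ_reflectionPerm_self (v : weightLattice R) (i : ι) :
    pairZ R v (R.reflectionPerm i i) = -pairZ R v i := by
  have : (pairZ R v (R.reflectionPerm i i) : ℝ) = (-pairZ R v i : ℤ) := by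
    rw [pairZ_spec, Int.cast_neg, pairZ_spec]
    simp
  exact_mod_cast this

lemma weight_eq_refl_smul_add (v : weightLattice R) (i : ι) :
    v = refl R i • v + pairZ R v i • rootWeight R i := by
  apply Subtype.ext
  rw [Submodule.coe_add, coe_smul_weight, Submodule.coe_smul]
  have h : refl R i • (v : V) = (v : V) - (pairZ R v i : ℝ) • R.root i := by
    rw [pairZ_spec]
    exact R.reflection_apply i v
  rw [h, Int.cast_smul_eq_zsmul]
  simp [rootWeight]

variable [Finite ι] [R.IsReduced] [R.IsRootSystem]

variable (R) in
/-- A weight, as an element of the twisted group ring. -/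
def weightT (v : weightLattice R) : TwistedRing R := scalarS R (SymmetricAlgebra.ι ℤ _ v)

lemma weightT_add (v v' : weightLattice R) : weightT R (v + v') = weightT R v + weightT R v' := by
  simp [weightT]

lemma weightT_zsmul (n : ℤ) (v : weightLattice R) : weightT R (n • v) = n • weightT R v := by
  simp [weightT]

-- Instance search finds no `SMulCommClass ℤ` for the twisted group ring, so `mul_smul_comm` does not
-- apply there.
lemma mul_zsmul_twisted (z z' : TwistedRing R) (n : ℤ) : z * (n • z') = n • (z * z') :=
  map_zsmul (AddMonoidHom.mulLeft z) n z'

lemma zsmul_mul_twisted (z z' : TwistedRing R) (n : ℤ) : (n • z) * z' = n • (z * z') :=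
  map_zsmul (AddMonoidHom.mulRight z') n z

lemma weightT_rootWeight (i : ι) : weightT R (rootWeight R i) = scalar R (rootF R i) := rfl

lemma delta_mul_weightT (x : ExtAffWeyl R) (v : weightLattice R) :
    delta R x * weightT R v = weightT R (finPart R x • v) * delta R x := by
  simp only [weightT, scalarS, RingHom.comp_apply]
  rw [delta_mul_scalar, weyl_smul_algebraMap, smul_ι]

lemma rootF_reflectionPerm_self (i : ι) : rootF R (R.reflectionPerm i i) = -rootF R i := by
  have : rootWeight R (R.reflectionPerm i i) = -rootWeight R i :=
    Subtype.ext (root_negIdx i)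
  rw [rootF, rootS, this, map_neg, map_neg]
  rfl

lemma simpleA_eq (s : Option b.support) :
    simpleA b θ s =
      scalar R (rootF R (simpleAff b θ s).1)⁻¹ * (1 - delta R (simpleRefl b θ s)) := by
  cases s with
  | some i => rfl
  | none =>
    rw [simpleAff, rootF_reflectionPerm_self, inv_neg]
    rfl

lemma finPart_simpleRefl (s : Option b.support) :
    finPart R (simpleRefl b θ s) = refl R (simpleAff b θ s).1 := by
  rw [simpleRefl_eq, finPart_affRefl]

lemma simpleA_mul_self (s : Option b.support) : simpleA b θ s * simpleA b θ s = 0 := by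
  set f := (rootF R (simpleAff b θ s).1)⁻¹ with hf
  set D := delta R (simpleRefl b θ s) with hD
  have h1 : D * scalar R f = -(scalar R f * D) := by
    have h0 : refl R (simpleAff b θ s).1 • f = -f := by
      rw [hf, smul_inv'', refl_smul_rootF, rootF_reflectionPerm_self, inv_neg]
    have h0' : scalar R (-f) = -scalar R f := (scalar R).map_neg f
    rw [hD, delta_mul_scalar, finPart_simpleRefl, h0, h0']
    exact neg_mul (scalar R f) _
  have h2 : D * D = 1 := by
    rw [hD, delta_mul, simpleRefl_mul_self, delta_one]
  have h3 : (1 - D) * scalar R f = scalar R f * (1 + D) := by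
    rw [sub_mul, h1, one_mul, sub_neg_eq_add, mul_add, mul_one]
  have h4 : (1 + D) * (1 - D) = 0 := by
    rw [add_mul, one_mul, mul_sub, h2, mul_one]
    abel
  rw [simpleA_eq, ← hf, ← hD, mul_assoc, ← mul_assoc (1 - D), h3, mul_assoc, h4, mul_zero, mul_zero]

/-- The commutation relation between `A_i` and a weight. -/
lemma simpleA_mul_weightT (s : Option b.support) (v : weightLattice R) :
    simpleA b θ s * weightT R v = weightT R (finPart R (simpleRefl b θ s) • v) * simpleA b θ s +
      pairZ R v (simpleAff b θ s).1 • 1 := by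
  set i := (simpleAff b θ s).1 with hi
  set D := delta R (simpleRefl b θ s) with hD
  set f := (rootF R i)⁻¹ with hf
  have h1 : D * weightT R v = weightT R (refl R i • v) * D := by
    rw [hD, delta_mul_weightT, finPart_simpleRefl]
  have h2 : weightT R v = weightT R (refl R i • v) + pairZ R v i • scalar R (rootF R i) := by
    conv_lhs => rw [weight_eq_refl_smul_add v i]
    rw [weightT_add, weightT_zsmul, weightT_rootWeight]
  have h3 : scalar R f * scalar R (rootF R i) = 1 := by
    rw [← map_mul, inv_mul_cancel₀ (rootF_ne_zero i), map_one]
  have h4 : scalar R f * weightT R (refl R i • v) = weightT R (refl R i • v) * scalar R f := by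
    simp only [weightT, scalarS, RingHom.comp_apply]
    rw [← map_mul, mul_comm, map_mul]
  rw [simpleA_eq, ← hi, ← hD, ← hf, finPart_simpleRefl, ← hi, mul_assoc, sub_mul, one_mul, h1]
  conv_lhs => rw [h2]
  rw [← mul_assoc (weightT R _), ← h4, mul_assoc, mul_sub, mul_sub, mul_sub, mul_add,
    mul_one, mul_zsmul_twisted, h3]
  abel

lemma single_mul_simpleA (x : ExtAffWeyl R) (f : FracS R) (s : Option b.support) :
    ∃ g, SkewMonoidAlgebra.single x f * simpleA b θ s =
      SkewMonoidAlgebra.single x g - SkewMonoidAlgebra.single (x * simpleRefl b θ s) g := by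
  refine ⟨f * finPart R x • (rootF R (simpleAff b θ s).1)⁻¹, ?_⟩
  rw [simpleA_eq, single_eq, mul_assoc, ← mul_assoc (delta R x), delta_mul_scalar, mul_assoc,
    mul_sub, mul_one, delta_mul, ← mul_assoc, ← map_mul, mul_sub, single_eq, single_eq]

variable (R) in
/-- The augmentation `∑ f_x δ_x ↦ ∑ f_x`. -/
def augmentation : TwistedRing R →+ FracS R :=
  SkewMonoidAlgebra.liftNC (AddMonoidHom.id _) fun _ => 1

lemma augmentation_single (x : ExtAffWeyl R) (f : FracS R) :
    augmentation R (SkewMonoidAlgebra.single x f) = f := by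
  simp [augmentation]

lemma augmentation_mul_simpleA (z : TwistedRing R) (s : Option b.support) :
    augmentation R (z * simpleA b θ s) = 0 := by
  induction z using SkewMonoidAlgebra.induction_on' with
  | add z z' h h' => rw [add_mul, map_add, h, h', add_zero]
  | single x f =>
    obtain ⟨g, hg⟩ := single_mul_simpleA (b := b) (θ := θ) x f s
    rw [hg, map_sub, augmentation_single, augmentation_single, sub_self]

lemma proj_mul_simpleA (z : TwistedRing R) (i : b.support) :
    proj R (z * simpleA b θ (some i)) = 0 := by
  induction z using SkewMonoidAlgebra.induction_on' with
  | add z z' h h' => rw [add_mul, map_add, h, h', add_zero]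
  | single x f =>
    obtain ⟨g, hg⟩ := single_mul_simpleA (b := b) (θ := θ) x f (some i)
    have : transPart R (x * simpleRefl b θ (some i)) = transPart R x := by
      simp [transPart, simpleRefl, fin]
    rw [hg, map_sub, proj_single, proj_single, this, sub_self]

variable (b θ) in
/-- The product of the elements `A_i` along a word. -/
def wordA (L : List (Option b.support)) : TwistedRing R := (L.map (simpleA b θ)).prod

lemma wordA_append (L L' : List (Option b.support)) :
    wordA b θ (L ++ L') = wordA b θ L * wordA b θ L' := by
  simp [wordA]

lemma wordA_concat (L : List (Option b.support)) (s : Option b.support) :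
    wordA b θ (L ++ [s]) = wordA b θ L * simpleA b θ s := by
  simp [wordA]

/-- A product of elements `A_i` is supported on the subgroup generated by the corresponding simple
reflections. -/
lemma support_wordA_subset {H : Subgroup (ExtAffWeyl R)} {L : List (Option b.support)}
    (hL : ∀ s ∈ L, simpleRefl b θ s ∈ H) :
    ((wordA b θ L).support : Set (ExtAffWeyl R)) ⊆ H := by
  induction L with
  | nil =>
    intro x hx
    have : x ∈ (1 : TwistedRing R).support := hx
    have := SkewMonoidAlgebra.support_one_subset this
    rw [Finset.mem_one] at this
    rw [this]
    exact one_mem H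
  | cons s L ih =>
    classical
    intro x hx
    have h1 : x ∈ (simpleA b θ s * wordA b θ L).support := by simpa [wordA] using hx
    obtain ⟨y, hy, z, hz, rfl⟩ := Finset.mem_mul.1 (SkewMonoidAlgebra.support_mul _ _ h1)
    refine mul_mem ?_ (ih (fun t ht => hL t (List.mem_cons_of_mem s ht)) hz)
    obtain ⟨g, hg⟩ := single_mul_simpleA (b := b) (θ := θ) (1 : ExtAffWeyl R) (1 : FracS R) s
    rw [SkewMonoidAlgebra.single_one_one, one_mul, one_mul] at hg
    rw [hg, SkewMonoidAlgebra.mem_support_iff, SkewMonoidAlgebra.coeff_sub, Finsupp.sub_apply,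
      SkewMonoidAlgebra.coeff_single, SkewMonoidAlgebra.coeff_single] at hy
    by_cases h2 : (1 : ExtAffWeyl R) = y
    · rw [← h2]
      exact one_mem H
    · by_cases h3 : simpleRefl b θ s = y
      · rw [← h3]
        exact hL s List.mem_cons_self
      · rw [Finsupp.single_eq_of_ne' h2, Finsupp.single_eq_of_ne' h3, sub_zero] at hy
        exact absurd rfl hy

end Twisted

/-! ### The commutation formula -/

section WellDefined

variable {ι V N : Type*} [AddCommGroup V] [Module ℝ V] [AddCommGroup N] [Module ℝ N]
  {R : RootPairing ι ℝ V N} [R.IsCrystallographic] {b : R.Base} {θ : ι}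
  [Finite ι] [R.IsReduced] [R.IsRootSystem]

variable (b θ) in
/-- For all elements of length at most `n`, the element `Ã_x` can be computed from any reduced
expression. -/
def IndepUpTo (n : ℕ) : Prop :=
  ∀ τ ∈ alcoveStabilizer b θ, ∀ L : List (Option b.support),
    invCard b (τ * wordProd b θ L) = L.length → L.length ≤ n →
      tildeA b θ (τ * wordProd b θ L) = delta R τ * wordA b θ L

/-- The expression chosen in the definition of `Ã_x` is reduced. -/
lemma exists_tildeA_eq (hθ : IsHighestRoot b θ) (x : ExtAffWeyl R) :
    ∃ τ ∈ alcoveStabilizer b θ, ∃ L : List (Option b.support), x = τ * wordProd b θ L ∧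
      L.length = invCard b x ∧ tildeA b θ x = delta R τ * wordA b θ L := by
  have h := Classical.epsilon_spec (exists_isReducedExpression hθ x)
  obtain ⟨h1, h2⟩ := (isReducedExpression_iff hθ).1 h
  exact ⟨_, (Classical.epsilon (IsReducedExpression b θ x)).1.2, _, h1, h2, rfl⟩

/-- `Ã_x A_s = Ã_{x s}` if the length goes up. -/
lemma tildeA_mul_simpleA (hθ : IsHighestRoot b θ) {n : ℕ} (hn : IndepUpTo b θ n)
    {x : ExtAffWeyl R} {s : Option b.support}
    (hs : AffPos b (affAct x (simpleAff b θ s))) (hx : invCard b x < n) :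
    tildeA b θ x * simpleA b θ s = tildeA b θ (x * simpleRefl b θ s) := by
  obtain ⟨τ, hτ, L, e, hl, hA⟩ := exists_tildeA_eq hθ x
  have h1 := invCard_mul_simpleRefl hθ hs
  have e1 : x * simpleRefl b θ s = τ * wordProd b θ (L ++ [s]) := by
    rw [wordProd_concat, ← mul_assoc, ← e]
  rw [e1, hn τ hτ _ (by rw [← e1, h1, List.length_append, hl]; rfl)
    (by rw [List.length_append, hl]; exact hx), hA, wordA_concat, mul_assoc]

/-- `Ã_x A_s = 0` if the length goes down. -/
lemma tildeA_mul_simpleA_of_neg (hθ : IsHighestRoot b θ) {n : ℕ} (hn : IndepUpTo b θ n)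
    {x : ExtAffWeyl R} {s : Option b.support}
    (hs : ¬ AffPos b (affAct x (simpleAff b θ s))) (hx : invCard b x ≤ n) :
    tildeA b θ x * simpleA b θ s = 0 := by
  have h1 := invCard_mul_simpleRefl_of_neg hθ hs
  have h2 : AffPos b (affAct (x * simpleRefl b θ s) (simpleAff b θ s)) := by
    rwa [affAct_mul, affAct_simpleRefl_self, affAct_affNeg, affPos_affNeg_iff]
  have h3 := tildeA_mul_simpleA hθ hn h2 (by omega)
  rw [mul_assoc x, simpleRefl_mul_self, mul_one] at h3
  rw [← h3, mul_assoc, simpleA_mul_self, mul_zero]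

variable (b θ) in
/-- The term `Ã_{x s_a}` of the commutation formula: it is counted only when `x s_a` is covered
by `x`. -/
def coverA (x : ExtAffWeyl R) (a : ι × ℤ) : TwistedRing R :=
  if invCard b (x * affRefl R a) + 1 = invCard b x then tildeA b θ (x * affRefl R a) else 0

variable (b) in
/-- The affine inversions of `x`, as a finite set. -/
def invFinset (x : ExtAffWeyl R) : Finset (ι × ℤ) := (inversions_finite b x).toFinset

lemma mem_invFinset {x : ExtAffWeyl R} {a : ι × ℤ} :
    a ∈ invFinset b x ↔ AffPos b a ∧ ¬ AffPos b (affAct x a) :=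
  Set.Finite.mem_toFinset _

variable (b θ) in
/-- The lower order terms of the commutation formula. -/
def lowerTerms (x : ExtAffWeyl R) (v : weightLattice R) : TwistedRing R :=
  ∑ a ∈ invFinset b x, pairZ R v a.1 • coverA b θ x a

lemma pairZ_refl_smul (v : weightLattice R) (i j : ι) :
    pairZ R v (R.reflectionPerm i j) = pairZ R (refl R i • v) j := by
  have h := pairZ_smul (refl R i) (refl R i • v) j
  rw [← mul_smul, refl_mul_self, one_smul] at h
  rw [← h]
  congr 1

/-- The elements covered by `x` and those covered by `x s` correspond under right multiplication
by `s`; the products `Ã_{x s_a} A_s` that do not occur in the formula for `x s` vanish because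
`A_s ^ 2 = 0`. -/
lemma coverA_mul_simpleA (hθ : IsHighestRoot b θ) {n : ℕ} (hn : IndepUpTo b θ n)
    {x : ExtAffWeyl R} {s : Option b.support}
    (hs : AffPos b (affAct x (simpleAff b θ s))) (hx : invCard b x ≤ n) {a : ι × ℤ}
    (ha : a ∈ inversions b x) :
    coverA b θ x a * simpleA b θ s =
      coverA b θ (x * simpleRefl b θ s) (affAct (simpleRefl b θ s) a) := by
  have e : x * simpleRefl b θ s * affRefl R (affAct (simpleRefl b θ s) a) =
      x * affRefl R a * simpleRefl b θ s := by
    rw [affRefl_affAct, simpleRefl_inv]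
    simp only [mul_assoc]
    rw [← mul_assoc (simpleRefl b θ s) (simpleRefl b θ s), simpleRefl_mul_self, one_mul]
  have h1 := invCard_mul_simpleRefl hθ hs
  have h2 := invCard_mul_affRefl_lt hθ ha
  rw [coverA, coverA, e, h1]
  by_cases h3 : AffPos b (affAct (x * affRefl R a) (simpleAff b θ s))
  · have h4 := invCard_mul_simpleRefl hθ h3
    rw [h4]
    by_cases h5 : invCard b (x * affRefl R a) + 1 = invCard b x
    · rw [if_pos h5, if_pos (by omega), tildeA_mul_simpleA hθ hn h3 (by omega)]
    · rw [if_neg h5, if_neg (by omega), zero_mul]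
  · have h4 := invCard_mul_simpleRefl_of_neg hθ h3
    rw [if_neg (c := invCard b (x * affRefl R a * simpleRefl b θ s) + 1 = _) (by omega)]
    split_ifs
    · exact tildeA_mul_simpleA_of_neg hθ hn h3 (by omega)
    · exact zero_mul _

lemma lowerTerms_mul_simpleRefl (hθ : IsHighestRoot b θ) {n : ℕ} (hn : IndepUpTo b θ n)
    {x : ExtAffWeyl R} {s : Option b.support}
    (hs : AffPos b (affAct x (simpleAff b θ s))) (hx : invCard b x ≤ n) (v : weightLattice R) :
    lowerTerms b θ (x * simpleRefl b θ s) v =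
      pairZ R v (simpleAff b θ s).1 • tildeA b θ x +
        lowerTerms b θ x (finPart R (simpleRefl b θ s) • v) * simpleA b θ s := by
  classical
  have e : invFinset b (x * simpleRefl b θ s) =
      insert (simpleAff b θ s) ((invFinset b x).image (affAct (simpleRefl b θ s))) := by
    apply Finset.coe_injective
    simp only [invFinset, Set.Finite.coe_toFinset, Finset.coe_insert, Finset.coe_image]
    exact inversions_mul_simpleRefl hθ hs
  have h1 : simpleAff b θ s ∉ (invFinset b x).image (affAct (simpleRefl b θ s)) := by
    have := simpleAff_notMem_image x s (b := b) (θ := θ)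
    rwa [← Finset.mem_coe, Finset.coe_image, invFinset, Set.Finite.coe_toFinset]
  rw [lowerTerms, e, Finset.sum_insert h1, Finset.sum_image (affAct_injective _).injOn]
  congr 1
  · rw [coverA, ← simpleRefl_eq, mul_assoc, simpleRefl_mul_self, mul_one,
      if_pos (invCard_mul_simpleRefl hθ hs).symm]
  · rw [lowerTerms, Finset.sum_mul]
    refine Finset.sum_congr rfl fun a ha => ?_
    rw [zsmul_mul_twisted, coverA_mul_simpleA hθ hn hs hx (mem_invFinset.1 ha), finPart_simpleRefl]
    congr 1
    rw [← pairZ_refl_smul, simpleRefl_eq, affAct_affRefl]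

/-- The commutation formula for `x` gives the one for `Ã_x A_s`, with lower order terms depending
only on `x s` and not on the chosen factorization. -/
lemma commutation_step (hθ : IsHighestRoot b θ) {n : ℕ} (hn : IndepUpTo b θ n)
    {x : ExtAffWeyl R} {s : Option b.support}
    (hs : AffPos b (affAct x (simpleAff b θ s))) (hx : invCard b x ≤ n)
    (h : ∀ v, tildeA b θ x * weightT R v =
      weightT R (finPart R x • v) * tildeA b θ x + lowerTerms b θ x v) (v : weightLattice R) :
    tildeA b θ x * simpleA b θ s * weightT R v =
      weightT R (finPart R (x * simpleRefl b θ s) • v) * (tildeA b θ x * simpleA b θ s) +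
        lowerTerms b θ (x * simpleRefl b θ s) v := by
  rw [lowerTerms_mul_simpleRefl hθ hn hs hx, mul_assoc, simpleA_mul_weightT, mul_add,
    ← mul_assoc, h, add_mul, mul_zsmul_twisted, mul_one, map_mul, mul_smul]
  simp only [mul_assoc]
  abel

/-- The commutation formula for `x` of length at most `n`, granted independence of reduced
expressions up to length `n`. -/
lemma tildeA_mul_weightT_of_indep (hθ : IsHighestRoot b θ) {n : ℕ} (hn : IndepUpTo b θ n)
    {x : ExtAffWeyl R} (hx : invCard b x ≤ n) (v : weightLattice R) :
    tildeA b θ x * weightT R v =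
      weightT R (finPart R x • v) * tildeA b θ x + lowerTerms b θ x v := by
  induction hm : invCard b x generalizing x v with
  | zero =>
    have h1 : invFinset b x = ∅ := by
      apply Finset.coe_injective
      rw [invFinset, Set.Finite.coe_toFinset, Finset.coe_empty]
      exact (Set.ncard_eq_zero (inversions_finite b x)).1 hm
    have h2 := hn x ((mem_alcoveStabilizer_iff hθ).2 hm) [] (by simpa using hm) (Nat.zero_le _)
    rw [wordProd_nil, mul_one] at h2
    have h3 : wordA b θ ([] : List (Option b.support)) = 1 := rfl
    rw [h2, h3, mul_one, delta_mul_weightT, lowerTerms, h1, Finset.sum_empty, add_zero]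
  | succ m ih =>
    obtain ⟨s, hs⟩ := exists_descent hθ (x := x) (by omega)
    have h1 := invCard_mul_simpleRefl_of_neg hθ hs
    have h2 : AffPos b (affAct (x * simpleRefl b θ s) (simpleAff b θ s)) := by
      rwa [affAct_mul, affAct_simpleRefl_self, affAct_affNeg, affPos_affNeg_iff]
    have h3 := commutation_step hθ hn h2 (by omega)
      (fun v => ih (by omega) v (by omega)) v
    rw [tildeA_mul_simpleA hθ hn h2 (by omega), mul_assoc x, simpleRefl_mul_self, mul_one] at h3
    exact h3

end WellDefined

/-! ### Independence of the reduced expression -/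

section Dihedral

variable {ι V N : Type*} [AddCommGroup V] [Module ℝ V] [AddCommGroup N] [Module ℝ N]
  {R : RootPairing ι ℝ V N} [R.IsCrystallographic] {b : R.Base} {θ : ι}
  [Finite ι] [R.IsReduced] [R.IsRootSystem]

lemma wordProd_reverse (L : List (Option b.support)) :
    wordProd b θ L.reverse = (wordProd b θ L)⁻¹ := by
  induction L with
  | nil => simp
  | cons s L ih =>
    rw [List.reverse_cons, wordProd_concat, ih, wordProd_cons, mul_inv_rev, simpleRefl_inv]

/-- If `y` has minimal length in its coset `y D`, where `D` is generated by the simple affine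
reflections in `J`, then the exchange property for `y d`, `d ∈ D`, deletes a letter of `d`. -/
lemma exists_eraseIdx_of_minimal (hθ : IsHighestRoot b θ) {J : Set (Option b.support)}
    {y : ExtAffWeyl R}
    (hy : ∀ L, (∀ r ∈ L, r ∈ J) → invCard b y ≤ invCard b (y * wordProd b θ L))
    {L : List (Option b.support)} (hL : ∀ r ∈ L, r ∈ J) {s : Option b.support} (hs : s ∈ J)
    (h : ¬ AffPos b (affAct (y * wordProd b θ L) (simpleAff b θ s))) :
    ∃ k < L.length, wordProd b θ L * simpleRefl b θ s = wordProd b θ (L.eraseIdx k) := by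
  obtain ⟨⟨τ, M⟩, he, hM⟩ := exists_isExpression hθ y
  have he' : y = τ * wordProd b θ M := he
  simp only at hM
  have h1 : ¬ AffPos b (affAct (wordProd b θ (M ++ L)) (simpleAff b θ s)) := by
    rwa [he', mul_assoc, ← wordProd_append, affAct_mul, affPos_affAct_stabilizer_iff hθ τ.2] at h
  obtain ⟨k, hk, e⟩ := exists_eraseIdx_of_neg hθ _ (affPos_simpleAff b θ s) h1
  rw [← simpleRefl_eq, wordProd_append] at e
  by_cases hkM : k < M.length
  · -- deleting a letter of `y` contradicts minimality
    exfalso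
    rw [List.eraseIdx_append_of_lt_length hkM, wordProd_append] at e
    have e1 : y * wordProd b θ (L ++ s :: L.reverse) = τ * wordProd b θ (M.eraseIdx k) := by
      rw [wordProd_append, wordProd_cons, wordProd_reverse, he']
      simp only [← mul_assoc]
      rw [mul_inv_eq_iff_eq_mul]
      simp only [mul_assoc] at e ⊢
      rw [e]
    have h2 := hy (L ++ s :: L.reverse) (by
      intro r hr
      simp only [List.mem_append, List.mem_cons, List.mem_reverse] at hr
      rcases hr with hr | rfl | hr
      exacts [hL r hr, hs, hL r hr])
    rw [e1] at h2
    have h3 := invCard_le_of_isExpression hθ (x := τ * wordProd b θ (M.eraseIdx k))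
      (e := (τ, M.eraseIdx k)) rfl
    rw [List.length_eraseIdx_of_lt hkM] at h3
    omega
  · push Not at hkM
    rw [List.eraseIdx_append_of_length_le hkM, wordProd_append, mul_assoc] at e
    refine ⟨k - M.length, ?_, mul_left_cancel e⟩
    rw [List.length_append] at hk
    omega

/-- If `y` has minimal length in its coset `y D`, then multiplication by a shortest word of an
element of `D` is length additive. -/
lemma invCard_mul_wordProd_of_minimal (hθ : IsHighestRoot b θ) {J : Set (Option b.support)}
    {y : ExtAffWeyl R}
    (hy : ∀ L, (∀ r ∈ L, r ∈ J) → invCard b y ≤ invCard b (y * wordProd b θ L))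
    {L : List (Option b.support)} (hL : ∀ r ∈ L, r ∈ J)
    (hmin : ∀ L', (∀ r ∈ L', r ∈ J) → wordProd b θ L' = wordProd b θ L → L.length ≤ L'.length) :
    invCard b (y * wordProd b θ L) = invCard b y + L.length := by
  induction L using List.reverseRecOn with
  | nil => simp
  | append_singleton L s ih =>
    have hs : s ∈ J := hL s (by simp)
    have hL' : ∀ r ∈ L, r ∈ J := fun r hr => hL r (by simp [hr])
    have h1 := ih hL' fun L' h e => by
      have := hmin (L' ++ [s]) (by
        intro r hr
        simp only [List.mem_append, List.mem_singleton] at hr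
        rcases hr with hr | rfl
        exacts [h r hr, hs]) (by rw [wordProd_concat, wordProd_concat, e])
      simpa using this
    rw [wordProd_concat, ← mul_assoc, List.length_append, List.length_singleton, ← add_assoc, ← h1]
    refine invCard_mul_simpleRefl hθ ?_
    by_contra h2
    obtain ⟨k, hk, e⟩ := exists_eraseIdx_of_minimal hθ hy hL' hs h2
    have h3 := hmin (L.eraseIdx k) (fun r hr => hL' r (List.mem_of_mem_eraseIdx hr))
      (by rw [wordProd_concat, e])
    rw [List.length_append, List.length_singleton, List.length_eraseIdx_of_lt hk] at h3
    omega

/-- An element with right descents `s` and `t` is the length additive product of some `y` and an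
element of the group generated by `s` and `t` having reduced words ending in `s` and in `t`. -/
lemma exists_dihedral_decomposition (hθ : IsHighestRoot b θ) {x : ExtAffWeyl R}
    {s t : Option b.support} (hs : ¬ AffPos b (affAct x (simpleAff b θ s)))
    (ht : ¬ AffPos b (affAct x (simpleAff b θ t))) :
    ∃ (y : ExtAffWeyl R) (L M : List (Option b.support)),
      (∀ r ∈ L, r = s ∨ r = t) ∧ (∀ r ∈ M, r = s ∨ r = t) ∧ L.length = M.length ∧
      wordProd b θ (L ++ [s]) = wordProd b θ (M ++ [t]) ∧
      x = y * wordProd b θ (L ++ [s]) ∧ invCard b x = invCard b y + (L.length + 1) := by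
  let J : Set (Option b.support) := {r | r = s ∨ r = t}
  let D : Set (List (Option b.support)) := {L | ∀ r ∈ L, r ∈ J}
  obtain ⟨L₀, hL₀, hmin₀⟩ := (measure fun L => invCard b (x * wordProd b θ L)).wf.has_min D
    ⟨[], by simp [D]⟩
  set y := x * wordProd b θ L₀ with hy
  have hymin : ∀ L, (∀ r ∈ L, r ∈ J) → invCard b y ≤ invCard b (y * wordProd b θ L) := by
    intro L hL
    rw [hy, mul_assoc, ← wordProd_append]
    refine not_lt.1 (hmin₀ (L₀ ++ L) fun r hr => ?_)
    rcases List.mem_append.1 hr with hr | hr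
    exacts [hL₀ r hr, hL r hr]
  obtain ⟨K, ⟨hK, hxK⟩, hKmin⟩ := (measure List.length).wf.has_min
    {L | L ∈ D ∧ x = y * wordProd b θ L}
    ⟨L₀.reverse, fun r hr => hL₀ r (List.mem_reverse.1 hr), by
      rw [hy, wordProd_reverse, mul_inv_cancel_right]⟩
  have hKmin' : ∀ L', (∀ r ∈ L', r ∈ J) → wordProd b θ L' = wordProd b θ K →
      K.length ≤ L'.length := fun L' h e => not_lt.1 (hKmin L' ⟨h, by rw [e, ← hxK]⟩)
  have hadd := invCard_mul_wordProd_of_minimal hθ hymin hK hKmin'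
  rw [hxK] at hs ht
  obtain ⟨k, hk, ek⟩ := exists_eraseIdx_of_minimal hθ hymin hK (Or.inl rfl) hs
  obtain ⟨l, hl, el⟩ := exists_eraseIdx_of_minimal hθ hymin hK (Or.inr rfl) ht
  have e1 : wordProd b θ (K.eraseIdx k ++ [s]) = wordProd b θ K := by
    rw [wordProd_concat, ← ek, mul_assoc, simpleRefl_mul_self, mul_one]
  have e2 : wordProd b θ (K.eraseIdx l ++ [t]) = wordProd b θ K := by
    rw [wordProd_concat, ← el, mul_assoc, simpleRefl_mul_self, mul_one]
  refine ⟨y, K.eraseIdx k, K.eraseIdx l, fun r hr => hK r (List.mem_of_mem_eraseIdx hr),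
    fun r hr => hK r (List.mem_of_mem_eraseIdx hr), ?_, by rw [e1, e2], by rw [e1, ← hxK], ?_⟩
  · rw [List.length_eraseIdx_of_lt hk, List.length_eraseIdx_of_lt hl]
  · rw [← hxK] at hadd
    rw [hadd, List.length_eraseIdx_of_lt hk]
    omega

lemma smul_eq_of_affEval_eq_zero {s : Option b.support} {p : N}
    (h : affEval R (simpleAff b θ s) p = 0) : simpleRefl b θ s • p = p := by
  rw [simpleRefl_eq, affRefl_smul, h, zero_smul, sub_zero]

/-- The walls of `α_i` and `α_0` meet, except in rank one, where no element has both as right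
descents. -/
lemma exists_fixed_point_aux (hθ : IsHighestRoot b θ) {x : ExtAffWeyl R} {i : b.support}
    (hs : ¬ AffPos b (affAct x (simpleAff b θ (some i))))
    (ht : ¬ AffPos b (affAct x (simpleAff b θ none))) :
    ∃ p : N, affEval R (simpleAff b θ (some i)) p = 0 ∧ affEval R (simpleAff b θ none) p = 0 := by
  classical
  by_cases h : ∃ j ∈ b.support, j ≠ (i : ι)
  · obtain ⟨j, hj, hji⟩ := h
    obtain ⟨y, hy⟩ := exists_simple_values b fun k => if k = j then 1 else 0
    set m := R.toLinearMap (R.root θ) y with hm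
    have h1 : 1 ≤ m := by
      have := root_le_highestRoot hθ (y := y)
        (fun k hk => by rw [hy k hk]; split_ifs <;> norm_num) j
      rwa [hy j hj, if_pos rfl] at this
    have h2 : m ≠ 0 := by linarith
    refine ⟨m⁻¹ • y, ?_, ?_⟩
    · simp [affEval, simpleAff, hy i i.2, hji.symm]
    · simp [affEval, simpleAff, ← hm, h2]
  · -- in rank one, the two descents would make the constant function `1` negative
    exfalso
    push Not at h
    obtain ⟨p, -, hp⟩ := exists_regular_point hθ
    rw [hp, affEval_affAct] at hs ht
    have h1 := root_apply_eq_height b (y := x⁻¹ • p)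
      (c := R.toLinearMap (R.root i) (x⁻¹ • p)) (fun j hj => by rw [h j hj]) θ
    have h2 : (0 : ℝ) < b.height θ := by exact_mod_cast height_highestRoot_pos hθ
    simp only [affEval, simpleAff, root_negIdx, map_neg, LinearMap.neg_apply, h1,
      Int.cast_zero, add_zero, Int.cast_one, not_lt] at hs ht
    nlinarith

/-- The reflections in two right descents of an element have a common fixed point. -/
lemma exists_fixed_point (hθ : IsHighestRoot b θ) {x : ExtAffWeyl R} {s t : Option b.support}
    (hst : s ≠ t) (hs : ¬ AffPos b (affAct x (simpleAff b θ s)))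
    (ht : ¬ AffPos b (affAct x (simpleAff b θ t))) :
    ∃ p : N, simpleRefl b θ s • p = p ∧ simpleRefl b θ t • p = p := by
  suffices h : ∃ p : N, affEval R (simpleAff b θ s) p = 0 ∧ affEval R (simpleAff b θ t) p = 0 by
    obtain ⟨p, h1, h2⟩ := h
    exact ⟨p, smul_eq_of_affEval_eq_zero h1, smul_eq_of_affEval_eq_zero h2⟩
  rcases s with _ | i <;> rcases t with _ | j
  · exact absurd rfl hst
  · obtain ⟨p, h1, h2⟩ := exists_fixed_point_aux hθ ht hs
    exact ⟨p, h2, h1⟩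
  · exact exists_fixed_point_aux hθ hs ht
  · exact ⟨0, by simp [affEval, simpleAff], by simp [affEval, simpleAff]⟩

/-- If `C v = u(v) C` for all weights `v`, then `C` is supported on elements with the same finite
part as `u`. -/
lemma finPart_eq_of_twisted_comm {C : TwistedRing R} {u : ExtAffWeyl R}
    (hC : ∀ v, C * weightT R v = weightT R (finPart R u • v) * C) {z : ExtAffWeyl R}
    (hz : C.coeff z ≠ 0) : finPart R z = finPart R u := by
  apply Subtype.ext
  apply RootPairing.Equiv.weightHom_injective
  refine LinearEquiv.toLinearMap_injective ?_
  refine LinearMap.ext_on_range (v := R.root) (RootPairing.IsRootSystem.span_root_eq_top (P := R))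
    fun i => ?_
  let w (v : weightLattice R) : FracS R :=
    algebraMap (SymP R) (FracS R) (SymmetricAlgebra.ι ℤ (weightLattice R) v)
  have h := congrArg (fun a => a.coeff z) (hC (rootWeight R i))
  have h1 : (weightT R (finPart R u • rootWeight R i) * C).coeff z =
      w (finPart R u • rootWeight R i) * C.coeff z :=
    SkewMonoidAlgebra.coeff_single_one_mul _ _ _
  have h2 : (C * weightT R (rootWeight R i)).coeff z = C.coeff z * z • w (rootWeight R i) :=
    SkewMonoidAlgebra.coeff_mul_single_one _ _ _
  simp only [h1, h2] at h
  rw [mul_comm] at h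
  have h3 := mul_right_cancel₀ hz h
  rw [ext_smul_def, weyl_smul_algebraMap, (FaithfulSMul.algebraMap_injective _ _).eq_iff,
    smul_ι, ι_injective.eq_iff] at h3
  exact congrArg Subtype.val h3

/-- A twisted-commuting element with augmentation zero, supported on the stabilizer of a point
that also contains `u`, vanishes. -/
lemma eq_zero_of_twisted_comm {C : TwistedRing R} {u : ExtAffWeyl R} {p : N}
    (hC : ∀ v, C * weightT R v = weightT R (finPart R u • v) * C)
    (hsupp : ∀ z ∈ C.support, z • p = p) (hu : u • p = p) (haug : augmentation R C = 0) :
    C = 0 := by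
  have h1 : ∀ z, C.coeff z ≠ 0 → z = u := by
    intro z hz
    have h2 := finPart_eq_of_twisted_comm hC hz
    have h3 := hsupp z (SkewMonoidAlgebra.mem_support_iff.2 hz)
    rw [smul_def, h2] at h3
    have h4 : (transPart R z : N) = transPart R u := by
      rw [smul_def] at hu
      exact add_left_cancel (h3.trans hu.symm)
    exact SemidirectProduct.ext (Subtype.ext h4) h2
  have h2 : C = SkewMonoidAlgebra.single u (C.coeff u) := by
    refine SkewMonoidAlgebra.ext fun z => ?_
    rw [SkewMonoidAlgebra.coeff_single]
    by_cases hz : u = z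
    · rw [hz, Finsupp.single_eq_same]
    · rw [Finsupp.single_eq_of_ne' hz]
      by_contra h
      exact hz (h1 z h).symm
  rw [h2, augmentation_single] at haug
  rw [h2, haug, SkewMonoidAlgebra.single_zero_right]

/-- Words ending in different right descents give the same product: the braid relations. -/
lemma wordA_dihedral_eq (hθ : IsHighestRoot b θ) {n : ℕ} (hn : IndepUpTo b θ n)
    {s t : Option b.support} (hst : s ≠ t) {L M : List (Option b.support)}
    (hL : ∀ r ∈ L, r = s ∨ r = t) (hM : ∀ r ∈ M, r = s ∨ r = t) (hLM : L.length = M.length)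
    (hprod : wordProd b θ (L ++ [s]) = wordProd b θ (M ++ [t]))
    (hinv : invCard b (wordProd b θ (L ++ [s])) = L.length + 1) (hLn : L.length ≤ n) :
    wordA b θ (L ++ [s]) = wordA b θ (M ++ [t]) := by
  set u := wordProd b θ (L ++ [s]) with hu
  have key : ∀ (K : List (Option b.support)) (r : Option b.support), K.length = L.length →
      u = wordProd b θ (K ++ [r]) →
      ¬ AffPos b (affAct u (simpleAff b θ r)) ∧ ∀ v, wordA b θ (K ++ [r]) * weightT R v =
        weightT R (finPart R u • v) * wordA b θ (K ++ [r]) + lowerTerms b θ u v := by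
    intro K r hK huK
    have h1 := invCard_le_of_isExpression hθ (x := wordProd b θ K) (e := (1, K))
      (one_mul (wordProd b θ K)).symm
    simp only at h1
    have h2 : u = wordProd b θ K * simpleRefl b θ r := by rw [huK, wordProd_concat]
    have h3 := invCard_mul_simpleRefl_le hθ (wordProd b θ K) r
    rw [← h2] at h3
    have h4 : AffPos b (affAct (wordProd b θ K) (simpleAff b θ r)) := by
      by_contra h
      have := invCard_mul_simpleRefl_of_neg hθ h
      rw [← h2] at this
      omega
    refine ⟨?_, fun v => ?_⟩
    · rwa [h2, affAct_mul, affAct_simpleRefl_self, affAct_affNeg, affPos_affNeg_iff, not_not]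
    · have h5 := hn 1 (one_mem _) K (by rw [one_mul]; omega) (by omega)
      rw [one_mul, delta_one, one_mul] at h5
      have h6 := commutation_step hθ hn h4 (by omega)
        (tildeA_mul_weightT_of_indep hθ hn (by omega)) v
      rw [h5, ← wordA_concat, ← h2] at h6
      exact h6
  obtain ⟨hs, hL'⟩ := key L s rfl rfl
  obtain ⟨ht, hM'⟩ := key M t hLM.symm hprod
  obtain ⟨p, hps, hpt⟩ := exists_fixed_point hθ hst hs ht
  have hfix : ∀ r, r = s ∨ r = t →
      simpleRefl b θ r ∈ MulAction.stabilizer (ExtAffWeyl R) p := by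
    rintro r (rfl | rfl)
    exacts [hps, hpt]
  have hfixL : ∀ r ∈ L ++ [s], simpleRefl b θ r ∈ MulAction.stabilizer (ExtAffWeyl R) p := by
    intro r hr
    refine hfix r ?_
    rcases List.mem_append.1 hr with hr | hr
    exacts [hL r hr, Or.inl (List.mem_singleton.1 hr)]
  have hfixM : ∀ r ∈ M ++ [t], simpleRefl b θ r ∈ MulAction.stabilizer (ExtAffWeyl R) p := by
    intro r hr
    refine hfix r ?_
    rcases List.mem_append.1 hr with hr | hr
    exacts [hM r hr, Or.inr (List.mem_singleton.1 hr)]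
  refine sub_eq_zero.1 (eq_zero_of_twisted_comm (u := u) (p := p) (fun v => ?_) (fun z hz => ?_)
    ?_ ?_)
  · rw [sub_mul, hL', hM', mul_sub]
    abel
  · by_contra hzp
    rw [SkewMonoidAlgebra.mem_support_iff] at hz
    apply hz
    have h1 : (wordA b θ (L ++ [s])).coeff z = 0 := by
      by_contra h
      exact hzp (support_wordA_subset hfixL (SkewMonoidAlgebra.mem_support_iff.2 h))
    have h2 : (wordA b θ (M ++ [t])).coeff z = 0 := by
      by_contra h
      exact hzp (support_wordA_subset hfixM (SkewMonoidAlgebra.mem_support_iff.2 h))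
    rw [SkewMonoidAlgebra.coeff_sub, Finsupp.sub_apply, h1, h2, sub_zero]
  · have : u ∈ MulAction.stabilizer (ExtAffWeyl R) p := by
      rw [hu, wordProd]
      refine list_prod_mem fun g hg => ?_
      obtain ⟨r, hr, rfl⟩ := List.mem_map.1 hg
      exact hfixL r hr
    exact this
  · rw [map_sub, wordA_concat, wordA_concat, augmentation_mul_simpleA, augmentation_mul_simpleA,
      sub_zero]

lemma tildeA_mul_simpleA_eq_of_descents (hθ : IsHighestRoot b θ) {n : ℕ} (hn : IndepUpTo b θ n)
    {x : ExtAffWeyl R} (hx : invCard b x = n + 1) {s t : Option b.support}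
    (hs : ¬ AffPos b (affAct x (simpleAff b θ s))) (ht : ¬ AffPos b (affAct x (simpleAff b θ t))) :
    tildeA b θ (x * simpleRefl b θ s) * simpleA b θ s =
      tildeA b θ (x * simpleRefl b θ t) * simpleA b θ t := by
  rcases eq_or_ne s t with rfl | hst
  · rfl
  obtain ⟨y, L, M, hL, hM, hLM, hprod, hxy, hlen⟩ := exists_dihedral_decomposition hθ hs ht
  obtain ⟨⟨τ, K⟩, he, hK⟩ := exists_isExpression hθ y
  have he' : y = τ * wordProd b θ K := he
  simp only at hK
  have h1 := invCard_mul_simpleRefl_of_neg hθ hs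
  have h2 := invCard_mul_simpleRefl_of_neg hθ ht
  have e1 : x * simpleRefl b θ s = τ * wordProd b θ (K ++ L) := by
    rw [hxy, wordProd_concat, wordProd_append, he', ← mul_assoc, mul_assoc _ (simpleRefl b θ s),
      simpleRefl_mul_self, mul_one]
    simp only [mul_assoc]
  have e2 : x * simpleRefl b θ t = τ * wordProd b θ (K ++ M) := by
    rw [hxy, hprod, wordProd_concat, wordProd_append, he', ← mul_assoc,
      mul_assoc _ (simpleRefl b θ t), simpleRefl_mul_self, mul_one]
    simp only [mul_assoc]
  have h3 := hn τ τ.2 (K ++ L) (by rw [← e1, List.length_append]; omega)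
    (by rw [List.length_append]; omega)
  have h4 := hn τ τ.2 (K ++ M) (by rw [← e2, List.length_append]; omega)
    (by rw [List.length_append]; omega)
  have h5 : invCard b (wordProd b θ (L ++ [s])) = L.length + 1 := by
    have h6 := invCard_mul_le (b := b) y (wordProd b θ (L ++ [s]))
    have h7 := invCard_le_of_isExpression hθ (x := wordProd b θ (L ++ [s]))
      (e := (1, L ++ [s])) (one_mul (wordProd b θ (L ++ [s]))).symm
    rw [← hxy] at h6
    simp only [List.length_append, List.length_singleton] at h7
    omega
  have h6 := wordA_dihedral_eq hθ hn hst hL hM hLM hprod h5 (by omega)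
  rw [wordA_concat, wordA_concat] at h6
  rw [e1, e2, h3, h4, wordA_append, wordA_append]
  simp only [mul_assoc]
  rw [h6]

/-- `Ã_x` does not depend on the choice of a reduced expression. -/
lemma indepUpTo (hθ : IsHighestRoot b θ) (n : ℕ) : IndepUpTo b θ n := by
  -- the last letter of a reduced word can be split off
  have split : ∀ (n : ℕ), IndepUpTo b θ n → ∀ τ ∈ alcoveStabilizer b θ,
      ∀ L : List (Option b.support), invCard b (τ * wordProd b θ L) = L.length →
      L.length = n + 1 →
      ∃ s, ¬ AffPos b (affAct (τ * wordProd b θ L) (simpleAff b θ s)) ∧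
        delta R τ * wordA b θ L =
          tildeA b θ (τ * wordProd b θ L * simpleRefl b θ s) * simpleA b θ s := by
    intro n hn τ hτ L h1 h2
    obtain rfl | ⟨L, s, rfl⟩ := List.eq_nil_or_concat L
    · simp at h2
    rw [List.concat_eq_append] at h1 h2 ⊢
    rw [List.length_append, List.length_singleton] at h1 h2
    have e : τ * wordProd b θ (L ++ [s]) = τ * wordProd b θ L * simpleRefl b θ s := by
      rw [wordProd_concat, mul_assoc]
    have e' : τ * wordProd b θ (L ++ [s]) * simpleRefl b θ s = τ * wordProd b θ L := by
      rw [e, mul_assoc _ (simpleRefl b θ s), simpleRefl_mul_self, mul_one]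
    have h3 := invCard_le_of_isExpression hθ (x := τ * wordProd b θ L) (e := (⟨τ, hτ⟩, L)) rfl
    simp only at h3
    have h4 : AffPos b (affAct (τ * wordProd b θ L) (simpleAff b θ s)) := by
      by_contra h
      have := invCard_mul_simpleRefl_of_neg hθ h
      rw [← e] at this
      omega
    have h5 := invCard_mul_simpleRefl hθ h4
    rw [← e] at h5
    refine ⟨s, ?_, ?_⟩
    · rwa [e, affAct_mul, affAct_simpleRefl_self, affAct_affNeg, affPos_affNeg_iff, not_not]
    · rw [e', hn τ hτ L (by omega) (by omega), wordA_concat, mul_assoc]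
  induction n with
  | zero =>
    intro τ hτ L h1 h2
    obtain rfl := List.length_eq_zero_iff.1 (Nat.le_zero.1 h2)
    obtain ⟨τ', hτ', L', e, hl, hA⟩ := exists_tildeA_eq hθ (τ * wordProd b θ [])
    rw [h1] at hl
    obtain rfl := List.length_eq_zero_iff.1 hl
    rw [hA, mul_right_cancel e]
  | succ n ih =>
    intro τ hτ L h1 h2
    rcases Nat.lt_or_eq_of_le h2 with h2 | h2
    · exact ih τ hτ L h1 (by omega)
    obtain ⟨τ', hτ', L', e, hl, hA⟩ := exists_tildeA_eq hθ (τ * wordProd b θ L)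
    obtain ⟨s, hs, es⟩ := split n ih τ hτ L h1 h2
    obtain ⟨t, ht, et⟩ := split n ih τ' hτ' L' (by rw [← e, hl]) (by omega)
    rw [← e] at ht et
    rw [hA, es, et]
    exact tildeA_mul_simpleA_eq_of_descents hθ ih (by omega) ht hs

/-- The commutation formula between `Ã_x` and a weight. -/
lemma tildeA_mul_weightT (hθ : IsHighestRoot b θ) (x : ExtAffWeyl R) (v : weightLattice R) :
    tildeA b θ x * weightT R v =
      weightT R (finPart R x • v) * tildeA b θ x + lowerTerms b θ x v :=
  tildeA_mul_weightT_of_indep hθ (indepUpTo hθ _) le_rfl v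

end Dihedral

/-! ### Antidominant coweights -/

section Antidominant

variable {ι V N : Type*} [AddCommGroup V] [Module ℝ V] [AddCommGroup N] [Module ℝ N]
  {R : RootPairing ι ℝ V N} [R.IsCrystallographic] {b : R.Base} {θ : ι}
  [Finite ι] [R.IsReduced] [R.IsRootSystem]

lemma copairZ_smul (w : R.weylGroup) (μ : coweightLattice R) (i : ι) :
    copairZ (w • μ) (R.weylGroupToPerm w i) = copairZ μ i := by
  have : (copairZ (w • μ) (R.weylGroupToPerm w i) : ℝ) = copairZ μ i := by
    rw [copairZ_spec, copairZ_spec, ← RootPairing.weylGroup_apply_root, coe_smul_coweight,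
      pairing_weyl]
  exact_mod_cast this

lemma copairZ_reflectionPerm_self (μ : coweightLattice R) (i : ι) :
    copairZ μ (R.reflectionPerm i i) = -copairZ μ i := by
  have : (copairZ μ (R.reflectionPerm i i) : ℝ) = (-copairZ μ i : ℤ) := by
    rw [copairZ_spec, Int.cast_neg, copairZ_spec, root_negIdx, map_neg]
    rfl
  exact_mod_cast this

lemma finPart_trans (μ : coweightLattice R) : finPart R (trans R μ) = 1 := rfl

lemma affAct_trans (μ : coweightLattice R) (a : ι × ℤ) :
    affAct (trans R μ) a = (a.1, a.2 - copairZ μ a.1) := by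
  simp only [affAct, finPart_trans, map_one]
  rfl

lemma affAct_fin (w : R.weylGroup) (a : ι × ℤ) :
    affAct (fin R w) a = (R.weylGroupToPerm w a.1, a.2) := by
  refine affEval_injective (R := R) fun y => ?_
  obtain ⟨y, rfl⟩ := MulAction.surjective (fin R w) y
  have h : fin R w • y = coweightRep R w y := by
    rw [smul_def]
    exact add_zero _
  change _ = affEval R _ (fin R w • y)
  change affEval R _ (fin R w • y) = _
  rw [affEval_affAct_smul, h, affEval, affEval, ← RootPairing.weylGroup_apply_root, pairing_weyl]

lemma mul_trans (x : ExtAffWeyl R) (μ : coweightLattice R) :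
    x * trans R μ = trans R (finPart R x • μ) * x := by
  refine eq_of_forall_smul_eq fun y => ?_
  have h : ∀ (ν : coweightLattice R) (z : N), trans R ν • z = z + ν := fun ν z => by
    rw [smul_def, finPart_trans, map_one]
    rfl
  rw [mul_smul, mul_smul, h, h, smul_def, smul_def, map_add, coe_smul_coweight]
  abel

lemma IsAntidominant.copairZ_nonpos {μ : coweightLattice R} (hμ : IsAntidominant b μ) {i : ι}
    (hi : b.IsPos i) : copairZ μ i ≤ 0 := by
  have h := root_nonneg b (y := -(μ : N))
    (fun j hj => by rw [map_neg]; exact neg_nonneg.2 (hμ j hj)) hi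
  rw [map_neg, neg_nonneg, ← copairZ_spec] at h
  exact_mod_cast h

/-- The length of a translation is invariant under the Weyl group: both lengths are
`∑ i, max ⟨α_i, μ⟩ 0`. -/
lemma invCard_trans_smul (w : R.weylGroup) (μ : coweightLattice R) :
    invCard b (trans R (w • μ)) = invCard b (trans R μ) := by
  classical
  have key : ∀ (w : R.weylGroup) (μ : coweightLattice R),
      invCard b (trans R μ) ≤ invCard b (trans R (w • μ)) := by
    intro w μ
    -- the least `k` such that `α_i + k δ` is positive
    let ε : ι → ℤ := fun i => if b.IsPos i then 0 else 1
    have hε : ∀ (i : ι) (k : ℤ), AffPos b (i, k) ↔ ε i ≤ k := by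
      intro i k
      by_cases h : b.IsPos i <;> simp [AffPos, ε, h] <;> omega
    refine Set.ncard_le_ncard_of_injOn
      (fun a => (R.weylGroupToPerm w a.1, a.2 - ε a.1 + ε (R.weylGroupToPerm w a.1))) ?_ ?_
      (inversions_finite b _)
    · rintro ⟨i, k⟩ ⟨h1, h2⟩
      rw [affAct_trans, hε] at h2
      rw [hε] at h1
      dsimp only at h2
      refine ⟨(hε _ _).2 (by dsimp only; omega), ?_⟩
      rw [affAct_trans, hε, copairZ_smul]
      dsimp only
      omega
    · rintro ⟨i, k⟩ - ⟨j, l⟩ - h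
      simp only [Prod.mk.injEq, EmbeddingLike.apply_eq_iff_eq] at h
      obtain ⟨rfl, h⟩ := h
      simpa using h
  refine le_antisymm ?_ (key w μ)
  have := key w⁻¹ (w • μ)
  rwa [inv_smul_smul] at this

/-- The translation by an antidominant coweight has minimal length in its coset. -/
lemma trans_mem_minReps (hθ : IsHighestRoot b θ) {μ : coweightLattice R}
    (hμ : IsAntidominant b μ) : trans R μ ∈ minReps b θ := by
  intro w
  rw [length_eq_invCard hθ, length_eq_invCard hθ]
  refine Set.ncard_le_ncard_of_injOn (affAct (fin R w)⁻¹) ?_ (affAct_injective _).injOn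
    (inversions_finite b _)
  rintro a ⟨h1, h2⟩
  refine ⟨?_, by rwa [affAct_mul, affAct_affAct_inv]⟩
  have e : (fin R w)⁻¹ = fin R w⁻¹ := (map_inv SemidirectProduct.inr w).symm
  rw [e, affAct_fin]
  rcases h1 with h1 | ⟨h1, h3⟩
  · exact Or.inl h1
  · exfalso
    apply h2
    rw [affAct_trans]
    have := hμ.copairZ_nonpos h3
    rcases this.lt_or_eq with h4 | h4
    · left
      simp only
      omega
    · exact Or.inr ⟨by simp only; omega, h3⟩

/-- The class `Ã_{t_ν} · [pt]` vanishes unless `ν` is antidominant. -/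
lemma proj_tildeA_trans (hθ : IsHighestRoot b θ) {ν : coweightLattice R}
    (hν : ¬ IsAntidominant b ν) : proj R (tildeA b θ (trans R ν)) = 0 := by
  simp only [IsAntidominant, not_forall, not_le] at hν
  obtain ⟨i, hi, h⟩ := hν
  rw [← copairZ_spec] at h
  have h0 : 0 < copairZ ν i := by exact_mod_cast h
  have h1 : ¬ AffPos b (affAct (trans R ν) (simpleAff b θ (some ⟨i, hi⟩))) := by
    rw [affAct_trans]
    simp only [AffPos, simpleAff]
    omega
  have h2 : AffPos b (affAct (trans R ν * simpleRefl b θ (some ⟨i, hi⟩))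
      (simpleAff b θ (some ⟨i, hi⟩))) := by
    rwa [affAct_mul, affAct_simpleRefl_self, affAct_affNeg, affPos_affNeg_iff]
  have h3 := tildeA_mul_simpleA hθ (indepUpTo hθ _) h2 (Nat.lt_succ_self _)
  rw [mul_assoc, simpleRefl_mul_self, mul_one] at h3
  rw [← h3, proj_mul_simpleA]

lemma closure_simple_refl (b : R.Base) :
    Subgroup.closure (refl R '' b.support) = ⊤ := by
  set K := Subgroup.closure (refl R '' (b.support : Set ι)) with hK
  have key : ∀ i j, refl R i ∈ K → refl R j ∈ K → refl R (R.reflectionPerm j i) ∈ K := by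
    intro i j hi hj
    rw [refl_conj]
    exact mul_mem (mul_mem hj hi) hj
  have simple : ∀ i ∈ b.support, refl R i ∈ K := fun i hi =>
    Subgroup.subset_closure ⟨i, hi, rfl⟩
  have all : ∀ i, refl R i ∈ K := fun i =>
    b.induction_reflect i (fun i hi => key i i hi hi) simple
      (fun i j hi hj => key i j hi (simple j hj))
  rw [eq_top_iff]
  rintro ⟨w, hw⟩ -
  induction hw using RootPairing.weylGroup.induction with
  | mem i => exact all i
  | one => exact one_mem K
  | mul x y hx hy h h' => exact mul_mem h h'

lemma exists_simple_word (w : R.weylGroup) :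
    ∃ L : List b.support, fin R w = wordProd b θ (L.map some) := by
  have hw : w ∈ Subgroup.closure (refl R '' b.support) := by
    rw [closure_simple_refl]
    exact Subgroup.mem_top w
  have hs : ∀ i : b.support, fin R (refl R i) = wordProd b θ [some i] := fun i =>
    (mul_one (simpleRefl b θ (some i))).symm
  induction hw using Subgroup.closure_induction with
  | mem w hw =>
    obtain ⟨i, hi, rfl⟩ := hw
    exact ⟨[⟨i, hi⟩], hs ⟨i, hi⟩⟩
  | one => exact ⟨[], map_one SemidirectProduct.inr⟩
  | mul w w' _ _ h h' =>
    obtain ⟨L, hL⟩ := h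
    obtain ⟨L', hL'⟩ := h'
    exact ⟨L ++ L', by rw [fin_mul, hL, hL', List.map_append, wordProd_append]⟩
  | inv w _ h =>
    obtain ⟨L, hL⟩ := h
    refine ⟨L.reverse, ?_⟩
    rw [List.map_reverse, wordProd_reverse, ← hL]
    exact map_inv SemidirectProduct.inr w

/-- An element of the Weyl group without inversions is trivial. -/
lemma eq_one_of_invCard_fin_eq_zero (hθ : IsHighestRoot b θ) {w : R.weylGroup}
    (hw : invCard b (fin R w) = 0) : w = 1 := by
  obtain ⟨L, hL, hmin⟩ := (measure List.length).wf.has_min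
    {L : List b.support | fin R w = wordProd b θ (L.map some)} (exists_simple_word w)
  have hL' : fin R w = wordProd b θ (L.map some) := hL
  obtain rfl | ⟨L, s, rfl⟩ := List.eq_nil_or_concat L
  · exact SemidirectProduct.inr_injective (hL'.trans (map_one _).symm)
  exfalso
  rw [List.concat_eq_append, List.map_append, List.map_singleton, wordProd_concat] at hL'
  have h1 : AffPos b (affAct (fin R w) (simpleAff b θ (some s))) :=
    affPos_affAct_of_mem_alcoveStabilizer hθ ((mem_alcoveStabilizer_iff hθ).2 hw)
      (affPos_simpleAff b θ _)
  rw [hL', affAct_mul, affAct_simpleRefl_self, affAct_affNeg, affPos_affNeg_iff] at h1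
  obtain ⟨k, hk, e⟩ := exists_eraseIdx_of_neg hθ _ (affPos_simpleAff b θ _) h1
  rw [← simpleRefl_eq, ← hL', List.eraseIdx_map] at e
  refine hmin (L.eraseIdx k) e ?_
  rw [List.length_map] at hk
  change (L.eraseIdx k).length < (L.concat s).length
  rw [List.length_eraseIdx_of_lt hk, List.length_concat]
  omega

variable (b) in
/-- The simple reflections fixing a coweight. -/
def fixingSimpleRefls (μ : coweightLattice R) : Set R.weylGroup :=
  {s | ∃ i ∈ b.support, R.toLinearMap (R.root i) (μ : N) = 0 ∧ s = refl R i}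

lemma closure_fixingSimpleRefls_le (μ : coweightLattice R) :
    Subgroup.closure (fixingSimpleRefls b μ) ≤ MulAction.stabilizer R.weylGroup μ := by
  rw [Subgroup.closure_le]
  rintro _ ⟨i, -, h, rfl⟩
  refine Subtype.ext ?_
  rw [coe_smul_coweight, coweightRep_refl, h, zero_smul, sub_zero]

/-- If `μ` and `w μ` are both antidominant, then `w` is a product of simple reflections
fixing `μ`. -/
lemma mem_closure_of_isAntidominant_smul (hθ : IsHighestRoot b θ) {μ : coweightLattice R}
    (hμ : IsAntidominant b μ) {w : R.weylGroup} (hw : IsAntidominant b (w • μ)) :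
    w ∈ Subgroup.closure (fixingSimpleRefls b μ) := by
  induction hn : invCard b (fin R w) generalizing w with
  | zero =>
    rw [eq_one_of_invCard_fin_eq_zero hθ hn]
    exact one_mem _
  | succ n ih =>
    obtain ⟨s, hs⟩ := exists_descent hθ (x := fin R w) (by omega)
    have h1 := invCard_mul_simpleRefl_of_neg hθ hs
    rw [affAct_fin] at hs
    rcases s with _ | i
    · exact absurd (Or.inl Int.one_pos) hs
    have h2 : b.IsPos (R.reflectionPerm (R.weylGroupToPerm w i) (R.weylGroupToPerm w i)) := by
      rw [RootPairing.Base.isPos_iff, height_negIdx]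
      have h3 := b.height_ne_zero (R.weylGroupToPerm w i)
      have h4 : ¬ 0 < b.height (R.weylGroupToPerm w i) := fun h => hs (Or.inr ⟨rfl, h⟩)
      omega
    have h3 := hw.copairZ_nonpos h2
    rw [copairZ_reflectionPerm_self, copairZ_smul] at h3
    have h4 := hμ.copairZ_nonpos (RootPairing.Base.isPos_of_mem_support i.2)
    have h5 : R.toLinearMap (R.root i) (μ : N) = 0 := by
      rw [← copairZ_spec, show copairZ μ i = 0 by omega, Int.cast_zero]
    have h6 : refl R (i : ι) ∈ Subgroup.closure (fixingSimpleRefls b μ) :=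
      Subgroup.subset_closure ⟨i, i.2, h5, rfl⟩
    have h7 : refl R (i : ι) • μ = μ := closure_fixingSimpleRefls_le μ h6
    have h8 := ih (w := w * refl R i) (by rwa [mul_smul, h7]) (by
      rw [fin_mul]
      change invCard b (fin R w * simpleRefl b θ (some i)) = n
      omega)
    have h9 := mul_mem h8 h6
    rwa [mul_assoc, refl_mul_self, mul_one] at h9

lemma closure_fixingSimpleRefls (hθ : IsHighestRoot b θ) {μ : coweightLattice R}
    (hμ : IsAntidominant b μ) :
    Subgroup.closure (fixingSimpleRefls b μ) = MulAction.stabilizer R.weylGroup μ := by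
  refine le_antisymm (closure_fixingSimpleRefls_le μ) fun w hw => ?_
  refine mem_closure_of_isAntidominant_smul hθ hμ ?_
  rw [MulAction.mem_stabilizer_iff.1 hw]
  exact hμ

/-- Each orbit contains at most one antidominant coweight. -/
lemma not_isAntidominant_smul (hθ : IsHighestRoot b θ) {μ : coweightLattice R}
    (hμ : IsAntidominant b μ) {w : R.weylGroup} (hw : w • μ ≠ μ) : ¬ IsAntidominant b (w • μ) :=
  fun h => hw (closure_fixingSimpleRefls_le μ (mem_closure_of_isAntidominant_smul hθ hμ h))

lemma finite_weylGroup : Finite R.weylGroup := by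
  refine Finite.of_injective (fun w i => R.weylGroupToPerm w i) fun w w' h => ?_
  apply Subtype.ext
  apply RootPairing.Equiv.weightHom_injective
  refine LinearEquiv.toLinearMap_injective ?_
  refine LinearMap.ext_on_range (v := R.root) (RootPairing.IsRootSystem.span_root_eq_top (P := R))
    fun i => ?_
  change w • R.root i = w' • R.root i
  rw [RootPairing.weylGroup_apply_root, RootPairing.weylGroup_apply_root]
  exact congrArg R.root (congrFun h i)

/-! ### The orbit sum -/

lemma refl_reflectionPerm_self (i : ι) : refl R (R.reflectionPerm i i) = refl R i := by
  rw [refl_conj, refl_mul_self, one_mul]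

lemma copairZ_refl_smul_self (i : ι) (ν : coweightLattice R) :
    copairZ (refl R i • ν) i = -copairZ ν i := by
  have h := copairZ_smul (refl R i) (refl R i • ν) i
  rw [← mul_smul, refl_mul_self, one_smul] at h
  rw [← h, ← copairZ_reflectionPerm_self]
  rfl

/-- The pairs `(ν, a)` and `(s_a ν, -t_ν a)` contribute the same element `t_ν s_a`. -/
lemma trans_mul_affRefl_partner (ν : coweightLattice R) (a : ι × ℤ) :
    trans R (refl R a.1 • ν) * affRefl R (affNeg R (affAct (trans R ν) a)) =
      trans R ν * affRefl R a := by
  have h1 := mul_trans (affRefl R a) ν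
  rw [finPart_affRefl] at h1
  have h2 : trans R (refl R a.1 • ν) * trans R ν = trans R ν * trans R (refl R a.1 • ν) := by
    rw [mul_trans (trans R ν), finPart_trans, one_smul]
  rw [affRefl_affNeg, affRefl_affAct, ← mul_assoc, ← mul_assoc, h2, mul_assoc (trans R ν), ← h1,
    mul_assoc, mul_assoc, mul_inv_cancel, mul_one]

lemma affAct_trans_partner (ν : coweightLattice R) (a : ι × ℤ) :
    affAct (trans R (refl R a.1 • ν)) (affNeg R (affAct (trans R ν) a)) = affNeg R a := by
  rw [affAct_affNeg, affAct_trans, affAct_trans, copairZ_refl_smul_self]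
  congr 1
  ext
  · rfl
  · simp

/-- The lower order terms of the commutation formula cancel over a Weyl group orbit of
translations. -/
lemma sum_lowerTerms_eq_zero (μ : coweightLattice R) (v : weightLattice R)
    [Fintype (R.weylGroup ⧸ MulAction.stabilizer R.weylGroup μ)] :
    ∑ q : R.weylGroup ⧸ MulAction.stabilizer R.weylGroup μ,
      lowerTerms b θ (trans R (MulAction.ofQuotientStabilizer R.weylGroup μ q)) v = 0 := by
  classical
  set ν := MulAction.ofQuotientStabilizer R.weylGroup μ with hν
  have hνsmul : ∀ (w : R.weylGroup) q, ν (w • q) = w • ν q :=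
    MulAction.ofQuotientStabilizer_smul R.weylGroup μ
  simp only [lowerTerms]
  rw [Finset.sum_sigma']
  refine Finset.sum_involution
    (fun p _ => ⟨refl R p.2.1 • p.1, affNeg R (affAct (trans R (ν p.1)) p.2)⟩) ?_ ?_ ?_ ?_
  · rintro ⟨q, a⟩ -
    have h1 : invCard b (trans R (refl R a.1 • ν q)) = invCard b (trans R (ν q)) :=
      invCard_trans_smul _ _
    have h2 : pairZ R v (affNeg R (affAct (trans R (ν q)) a)).1 = -pairZ R v a.1 := by
      rw [affAct_trans]
      exact pairZ_reflectionPerm_self v a.1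
    simp only [hνsmul, coverA, trans_mul_affRefl_partner, h1, h2]
    rw [neg_smul, add_neg_cancel]
  · rintro ⟨q, a⟩ - - h
    simp only [Sigma.mk.injEq, heq_eq_eq] at h
    have h1 := congrArg Prod.fst h.2
    rw [affAct_trans] at h1
    have h2 := congrArg b.height h1
    simp only [affNeg, height_negIdx] at h2
    have := b.height_ne_zero a.1
    omega
  · rintro ⟨q, a⟩ h
    simp only [Finset.mem_sigma, Finset.mem_univ, true_and, mem_invFinset] at h ⊢
    rw [hνsmul, affAct_trans_partner, affPos_affNeg_iff, affPos_affNeg_iff, not_not]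
    exact ⟨h.2, h.1⟩
  · rintro ⟨q, a⟩ -
    simp only [hνsmul, affAct_trans_partner, affNeg_affNeg]
    congr 1
    rw [affAct_trans]
    change refl R (R.reflectionPerm a.1 a.1) • refl R a.1 • q = q
    rw [refl_reflectionPerm_self, ← mul_smul, refl_mul_self, one_smul]

lemma scalarS_mul_comm_of_weightT {z : TwistedRing R}
    (h : ∀ v, weightT R v * z = z * weightT R v) (s : SymP R) :
    scalarS R s * z = z * scalarS R s := by
  induction s using SymmetricAlgebra.induction with
  | algebraMap n =>
    rw [eq_intCast, map_intCast]
    exact Int.cast_comm n z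
  | ι v => exact h v
  | mul s s' hs hs' => rw [map_mul, mul_assoc, hs', ← mul_assoc, hs, mul_assoc]
  | add s s' hs hs' => rw [map_add, add_mul, mul_add, hs, hs']

/-- The orbit sum of the `Ã_{t_ν}` is its own image under `j ∘ (· [pt])`, as it commutes
with `S`. -/
lemma locJ_proj_orbit_sum (hθ : IsHighestRoot b θ) (μ : coweightLattice R)
    [Fintype (R.weylGroup ⧸ MulAction.stabilizer R.weylGroup μ)] :
    locJ R (proj R (∑ q : R.weylGroup ⧸ MulAction.stabilizer R.weylGroup μ,
      tildeA b θ (trans R (MulAction.ofQuotientStabilizer R.weylGroup μ q)))) =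
    ∑ q : R.weylGroup ⧸ MulAction.stabilizer R.weylGroup μ,
      tildeA b θ (trans R (MulAction.ofQuotientStabilizer R.weylGroup μ q)) := by
  refine locJ_proj_of_comm (scalarS_mul_comm_of_weightT fun v => ?_)
  rw [Finset.sum_mul]
  simp only [tildeA_mul_weightT hθ]
  rw [Finset.sum_add_distrib, sum_lowerTerms_eq_zero, add_zero, Finset.mul_sum]
  simp only [finPart_trans, one_smul]

end Antidominant

end AffineNilHecke

end

theorem mainTheorem4 {ι V N : Type*} [Finite ι] [AddCommGroup V] [Module ℝ V]
    [AddCommGroup N] [Module ℝ N] (R : RootPairing ι ℝ V N) [R.IsRootSystem]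
    [R.IsCrystallographic] [R.IsReduced] [R.IsIrreducible]
    (b : R.Base) (θ : ι) (hθ : AffineNilHecke.IsHighestRoot b θ)
    (μ : AffineNilHecke.coweightLattice R) (hμ : AffineNilHecke.IsAntidominant b μ) :
    Subgroup.closure {s : R.weylGroup | ∃ i ∈ b.support,
        R.toLinearMap (R.root i) (μ : N) = 0 ∧ s = AffineNilHecke.refl R i} =
      MulAction.stabilizer R.weylGroup μ ∧
    ∃ h : AffineNilHecke.trans R μ ∈ AffineNilHecke.minReps b θ,
      (AffineNilHecke.jAd b θ (AffineNilHecke.schubertClass b θ ⟨_, h⟩) :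
          AffineNilHecke.TwistedRing R) =
        ∑ᶠ w : R.weylGroup ⧸ MulAction.stabilizer R.weylGroup μ,
          AffineNilHecke.tildeA b θ
            (AffineNilHecke.trans R (MulAction.ofQuotientStabilizer R.weylGroup μ w)) := by
  refine ⟨AffineNilHecke.closure_fixingSimpleRefls hθ hμ,
    AffineNilHecke.trans_mem_minReps hθ hμ, ?_⟩
  have := AffineNilHecke.finite_weylGroup (R := R)
  have := Fintype.ofFinite (R.weylGroup ⧸ MulAction.stabilizer R.weylGroup μ)
  rw [finsum_eq_sum_of_fintype, ← AffineNilHecke.locJ_proj_orbit_sum hθ μ, map_sum]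
  change AffineNilHecke.locJ R (AffineNilHecke.proj R
    (AffineNilHecke.tildeA b θ (AffineNilHecke.trans R μ))) = _
  congr 1
  rw [Finset.sum_eq_single (QuotientGroup.mk 1)]
  · rw [MulAction.ofQuotientStabilizer_mk, one_smul]
  · intro q _ hq
    induction q using QuotientGroup.induction_on with
    | H w =>
      rw [MulAction.ofQuotientStabilizer_mk]
      refine AffineNilHecke.proj_tildeA_trans hθ
        (AffineNilHecke.not_isAntidominant_smul hθ hμ fun hw => hq ?_)
      apply MulAction.injective_ofQuotientStabilizer R.weylGroup μ
      rw [MulAction.ofQuotientStabilizer_mk, MulAction.ofQuotientStabilizer_mk, one_smul, hw]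
  · intro h
    exact absurd (Finset.mem_univ _) h
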